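/- Let $K$ be a field of characteristic zero endowed with a topology (for example $\mathbb{R}$ or $\mathbb{C}$ with the Euclidean topology, or an algebraically closed field of characteristic zero with the Zariski topology). Let $(X,\mathcal{O}_X)$ be a topological ringed space over $K$: a topological space $X$ with a sheaf $\mathcal{O}_X$ of $K$-algebras of continuous $K$-valued functions (with pointwise operations, containing the constants). Let $\mathcal{E}$ be an $\mathcal{O}_X$-module and let $(\mathcal{L},[\cdot,\cdot]_{\mathcal{L}},\mathfrak{a})$ be a Lie algebroid over $(X,\mathcal{O}_X)$: an $\mathcal{O}_X$-module and sheaf of $K$-Lie algebras with an anchor $\mathfrak{a}:\mathcal{L}\to \mathcal{D}er_K(\mathcal{O}_X)$ that is $\mathcal{O}_X$-linear, a morphism of Lie algebras, and satisfies $[D,fD']=f[D,D']+\mathfrak{a}(D)(f)D'$. For an $\mathcal{O}_X$-module $\mathcal{M}$ let $\wedge^\bullet\mathcal{M}=\bigoplus_{i\ge 0}\wedge^i_{\mathcal{O}_X}\mathcal{M}$ be the exterior algebra, i.e. the sheafification of $U\mapsto\wedge^\bullet_{\mathcal{O}_X(U)}\mathcal{M}(U)$, with $\wedge^i\mathcal{M}=0$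 for $i<0$. A Gerstenhaber structure on $\wedge^\bullet\mathcal{M}$ is a $K$-bilinear morphism of sheaves $[\cdot,\cdot]:\wedge^\bullet\mathcal{M}\times\wedge^\bullet\mathcal{M}\to\wedge^\bullet\mathcal{M}$ such that, for $a,b$ homogeneous of degrees $i,j$ and every $c$, the section $[a,b]$ has degree $i+j-1$ and $$[a,b]=-(-1)^{(i-1)(j-1)}[b,a],\qquad [a,[b,c]]=[[a,b],c]+(-1)^{(i-1)(j-1)}[b,[a,c]],$$ $$[a,b\wedge c]=[a,b]\wedge c+(-1)^{(i-1)j}\,b\wedge[a,c].$$ A Gerstenhaber morphism is a morphism of sheaves of graded unital $\mathcal{O}_X$-algebras that preserves the brackets. A Lie algebroid morphism is an $\mathcal{O}_X$-linear map that preserves the brackets and is compatible with the anchors. Then: 1. There is exactly one Gerstenhaber structure $[\cdot,\cdot]^{\mathcal{L}}$ on $\wedge^\bullet\mathcal{L}$ such that $[D,f]^{\mathcal{L}}=\mathfrak{a}(D)(f)$ for $D\in\mathcal{L}$, $f\in\mathcal{O}_X$, and, for all $1\le m<n$ and $D_1,\dots,D_n\in\mathcal{L}$, $$[D_1\wedge\cdots\wedge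 D_m,\,D_{m+1}\wedge\cdots\wedge D_n]^{\mathcal{L}}=\sum_{i\le m<j}(-1)^{i+j+m}[D_i,D_j]_{\mathcal{L}}\wedge D_1\wedge\cdots\widehat{D_i}\cdots\widehat{D_j}\cdots\wedge D_n .$$ Write $\mathcal{G}_{\mathcal{L}}=(\wedge^\bullet\mathcal{L},\wedge,[\cdot,\cdot]^{\mathcal{L}})$. 2. The exterior algebra $\wedge^\bullet\mathcal{E}$ carries a $\mathcal{G}_{\mathcal{L}}$-Gerstenhaber algebra structure, i.e. a Gerstenhaber structure $[\cdot,\cdot]^{\mathcal{E}}$ together with a Gerstenhaber morphism $\psi:(\wedge^\bullet\mathcal{E},[\cdot,\cdot]^{\mathcal{E}})\to\mathcal{G}_{\mathcal{L}}$, if and only if $\mathcal{E}$ carries an $\mathcal{L}$-Lie algebroid structure, i.e. a Lie algebroid structure $([\cdot,\cdot]_{\mathcal{E}},\mathfrak{a}')$ together with a Lie algebroid morphism $\phi:\mathcal{E}\to\mathcal{L}$. 3. More precisely, the two kinds of structure correspond bijectively by restriction: for each $([\cdot,\cdot]^{\mathcal{E}},\psi)$ there is exactly one $([\cdot,\cdot]_{\mathcal{E}},\mathfrak{a}',\phi)$,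 and for each $([\cdot,\cdot]_{\mathcal{E}},\mathfrak{a}',\phi)$ there is exactly one $([\cdot,\cdot]^{\mathcal{E}},\psi)$, such that $[D,D']^{\mathcal{E}}=[D,D']_{\mathcal{E}}$, $[D,f]^{\mathcal{E}}=\mathfrak{a}'(D)(f)$ and $\psi(D)=\phi(D)$ for all local sections $D,D'$ of $\mathcal{E}$ and $f$ of $\mathcal{O}_X$. -/

import Mathlib

open CategoryTheory Opposite TopologicalSpace

universe u

noncomputable section

/-- A topological ringed space `(X, 𝒪)` over a field `K` that carries a topology (Euclidean,
Zariski, ...): a subsheaf of `K`-algebras of the sheaf of continuous `K`-valued functions on `X`.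
Continuity is imposed section by section, because the algebra operations of `K` are not jointly
continuous for the Zariski topology. -/
structure TopRingedSpace (K : Type u) [Field K] [TopologicalSpace K] (X : TopCat.{u}) where
  /-- The algebra `𝒪(U)` of sections over `U`, with pointwise operations. -/
  sec : ∀ U : Opens X, Subalgebra K (U → K)
  continuous : ∀ (U : Opens X) (f : U → K), f ∈ sec U → Continuous f
  res_mem : ∀ {U V : Opens X} (h : V ≤ U) (f : U → K), f ∈ sec U →
    (fun x : V => f ⟨x.1, h x.2⟩) ∈ sec V
  local_mem : ∀ (U : Opens X) (f : U → K),
    (∀ x : U, ∃ (V : Opens X) (h : V ≤ U), x.1 ∈ V ∧ (fun y : V => f ⟨y.1, h y.2⟩) ∈ sec V) →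
    f ∈ sec U

namespace TopRingedSpace

variable {K : Type u} [Field K] [TopologicalSpace K] {X : TopCat.{u}} (𝒪 : TopRingedSpace K X)

/-- The ring `𝒪(U)` of sections over `U`. -/
def Γ (U : Opens X) : Type u := 𝒪.sec U

instance (U : Opens X) : CommRing (𝒪.Γ U) := inferInstanceAs (CommRing (𝒪.sec U))

instance (U : Opens X) : Algebra K (𝒪.Γ U) := inferInstanceAs (Algebra K (𝒪.sec U))

/-- Restriction of functions, as a homomorphism of `K`-algebras `𝒪(U) → 𝒪(V)`. -/
def res {U V : Opens X} (h : V ≤ U) : 𝒪.Γ U →ₐ[K] 𝒪.Γ V where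
  toFun f := ⟨fun x => f.1 ⟨x.1, h x.2⟩, 𝒪.res_mem h f.1 f.2⟩
  map_one' := rfl
  map_mul' _ _ := rfl
  map_zero' := rfl
  map_add' _ _ := rfl
  commutes' _ := rfl

/-- The structure sheaf as a presheaf of commutative rings. -/
def presheaf : TopCat.Presheaf CommRingCat.{u} X where
  obj U := CommRingCat.of (𝒪.Γ U.unop)
  map f := CommRingCat.ofHom (𝒪.res (leOfHom f.unop)).toRingHom

theorem isSheaf :
    Presheaf.IsSheaf (Opens.grothendieckTopology X)
      (𝒪.presheaf ⋙ forget₂ CommRingCat.{u} RingCat.{u}) := by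
  refine (TopCat.Presheaf.isSheaf_iff_isSheaf_comp (forget RingCat.{u})
    (𝒪.presheaf ⋙ forget₂ CommRingCat.{u} RingCat.{u})).2 ?_
  apply TopCat.Presheaf.isSheaf_of_isSheafUniqueGluing_types
  intro ι U sf hsf
  let s : ∀ i, 𝒪.Γ (U i) := sf
  have hs : ∀ (i j : ι) (x : X) (hi : x ∈ U i) (hj : x ∈ U j),
      (s i).1 ⟨x, hi⟩ = (s j).1 ⟨x, hj⟩ := by
    intro i j x hi hj
    exact congrFun (congrArg Subtype.val (hsf i j)) (⟨x, hi, hj⟩ : (U i ⊓ U j : Opens X))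
  have hex : ∀ x : (iSup U : Opens X), ∃ i, x.1 ∈ U i := fun x => Opens.mem_iSup.1 x.2
  choose idx hidx using hex
  have hmem : (fun x : (iSup U : Opens X) => (s (idx x)).1 ⟨x.1, hidx x⟩) ∈ 𝒪.sec (iSup U) := by
    refine 𝒪.local_mem _ _ fun x => ⟨U (idx x), le_iSup U _, hidx x, ?_⟩
    convert (s (idx x)).2 using 1
    funext y
    exact hs _ _ _ _ _
  refine ⟨(⟨_, hmem⟩ : 𝒪.Γ (iSup U)), ?_, ?_⟩
  · intro i
    refine Subtype.ext (funext fun y => ?_)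
    exact hs _ _ _ _ _
  · intro t ht
    refine Subtype.ext (funext fun y => ?_)
    exact congrFun (congrArg Subtype.val (ht (idx y))) (⟨y.1, hidx y⟩ : U (idx y))

/-- The structure sheaf as a sheaf of rings. -/
def sheaf : Sheaf (Opens.grothendieckTopology X) RingCat.{u} :=
  ⟨𝒪.presheaf ⋙ forget₂ CommRingCat.{u} RingCat.{u}, 𝒪.isSheaf⟩

/-- `𝒪`-modules: sheaves of modules over the structure sheaf. -/
abbrev Modules := SheafOfModules.{u} 𝒪.sheaf

end TopRingedSpace

namespace OModule

variable {K : Type u} [Field K] [TopologicalSpace K] {X : TopCat.{u}} {𝒪 : TopRingedSpace K X}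

/-- The sections `E(U)` of an `𝒪`-module `E`. -/
def Sec (E : 𝒪.Modules) (U : Opens X) : Type u := E.val.obj (op U)

instance (E : 𝒪.Modules) (U : Opens X) : AddCommGroup (Sec E U) :=
  inferInstanceAs (AddCommGroup (E.val.obj (op U)))

instance (E : 𝒪.Modules) (U : Opens X) : Module (𝒪.Γ U) (Sec E U) :=
  (E.val.obj (op U)).isModule

instance (E : 𝒪.Modules) (U : Opens X) : Module K (Sec E U) :=
  Module.compHom (Sec E U) (algebraMap K (𝒪.Γ U))

/-- Restriction of sections `E(U) → E(V)`, semilinear along `𝒪(U) → 𝒪(V)`. -/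
def res (E : 𝒪.Modules) {U V : Opens X} (h : V ≤ U) :
    Sec E U →ₛₗ[(𝒪.res h).toRingHom] Sec E V :=
  E.val.restrictₛₗ (homOfLE h).op

/-- The map `E(U) → F(U)` given by a morphism of `𝒪`-modules. -/
def app {E F : 𝒪.Modules} (φ : E ⟶ F) (U : Opens X) : Sec E U →ₗ[𝒪.Γ U] Sec F U :=
  (φ.val.app (op U)).hom

end OModule

namespace ExtAlg

variable {K : Type u} [Field K] [TopologicalSpace K] {X : TopCat.{u}} {𝒪 : TopRingedSpace K X}

open OModule

/-- The ring homomorphism `⋀_{𝒪(U)} E(U) → ⋀_{𝒪(V)} E(V)` induced by restriction. -/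
def presheafMap (E : 𝒪.Modules) {U V : Opens X} (h : V ≤ U) :
    ExteriorAlgebra (𝒪.Γ U) (Sec E U) →+* ExteriorAlgebra (𝒪.Γ V) (Sec E V) :=
  letI : Algebra (𝒪.Γ U) (ExteriorAlgebra (𝒪.Γ V) (Sec E V)) :=
    Algebra.compHom _ (𝒪.res h).toRingHom
  (ExteriorAlgebra.lift (𝒪.Γ U)
    (⟨{ toFun := fun D => ExteriorAlgebra.ι (𝒪.Γ V) (res E h D)
        map_add' := fun D D' => by rw [map_add, map_add]
        map_smul' := fun f D => by rw [LinearMap.map_smulₛₗ, LinearMap.map_smul]; rfl },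
      fun D => ExteriorAlgebra.ι_sq_zero _⟩ :
      { g : Sec E U →ₗ[𝒪.Γ U] ExteriorAlgebra (𝒪.Γ V) (Sec E V) //
        ∀ D, g D * g D = 0 })).toRingHom

theorem presheafMap_ι (E : 𝒪.Modules) {U V : Opens X} (h : V ≤ U) (D : Sec E U) :
    presheafMap E h (ExteriorAlgebra.ι (𝒪.Γ U) D) =
      ExteriorAlgebra.ι (𝒪.Γ V) (res E h D) := by
  let _ : Algebra (𝒪.Γ U) (ExteriorAlgebra (𝒪.Γ V) (Sec E V)) :=
    Algebra.compHom _ (𝒪.res h).toRingHom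
  exact ExteriorAlgebra.lift_ι_apply _ _ _ _

theorem presheafMap_algebraMap (E : 𝒪.Modules) {U V : Opens X} (h : V ≤ U) (f : 𝒪.Γ U) :
    presheafMap E h (algebraMap _ _ f) = algebraMap _ _ (𝒪.res h f) := by
  let _ : Algebra (𝒪.Γ U) (ExteriorAlgebra (𝒪.Γ V) (Sec E V)) :=
    Algebra.compHom _ (𝒪.res h).toRingHom
  exact AlgHom.commutes _ f

theorem ringHom_ext {A M B : Type*} [CommRing A] [AddCommGroup M] [Module A M] [Ring B]
    {f g : ExteriorAlgebra A M →+* B} 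
    (h0 : ∀ a, f (algebraMap A (ExteriorAlgebra A M) a) =
      g (algebraMap A (ExteriorAlgebra A M) a))
    (h1 : ∀ m, f (ExteriorAlgebra.ι A m) = g (ExteriorAlgebra.ι A m)) : f = g := by
  ext a
  induction a using ExteriorAlgebra.induction with
  | algebraMap r => exact h0 r
  | ι x => exact h1 x
  | mul a b ha hb => rw [map_mul, map_mul, ha, hb]
  | add a b ha hb => rw [map_add, map_add, ha, hb]

/-- The presheaf of rings `U ↦ ⋀_{𝒪(U)} E(U)`. -/
def presheaf (E : 𝒪.Modules) : (Opens X)ᵒᵖ ⥤ RingCat.{u} where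
  obj U := RingCat.of (ExteriorAlgebra (𝒪.Γ U.unop) (Sec E U.unop))
  map f := RingCat.ofHom (presheafMap E (leOfHom f.unop))
  map_id U := by
    refine RingCat.hom_ext (ringHom_ext (fun a => ?_) (fun m => ?_))
    · exact presheafMap_algebraMap E _ a
    · refine (presheafMap_ι E _ m).trans (congrArg _ ?_)
      exact (E.val.congr_map_apply (Subsingleton.elim _ (𝟙 U)) m).trans (by rw [E.val.map_id]; rfl)
  map_comp {U V W} f g := by
    refine RingCat.hom_ext (ringHom_ext (fun a => ?_) (fun m => ?_))
    · refine (presheafMap_algebraMap E _ a).trans ?_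
      refine Eq.symm ((congrArg _ (presheafMap_algebraMap E _ a)).trans ?_)
      exact presheafMap_algebraMap E _ _
    · refine (presheafMap_ι E _ m).trans ?_
      refine Eq.symm ((congrArg _ (presheafMap_ι E _ m)).trans ?_)
      refine (presheafMap_ι E _ _).trans (congrArg _ ?_)
      exact (E.val.map_comp_apply f g m).symm

/-- The exterior algebra `⋀ E` over `𝒪`: the sheafification of `U ↦ ⋀_{𝒪(U)} E(U)`. -/
def sheaf (E : 𝒪.Modules) : Sheaf (Opens.grothendieckTopology X) RingCat.{u} :=
  (presheafToSheaf (Opens.grothendieckTopology X) RingCat.{u}).obj (presheaf E)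

/-- The ring `(⋀ E)(U)` of sections over `U`; its multiplication is the exterior product. -/
def Sec (E : 𝒪.Modules) (U : Opens X) : Type u := (sheaf E).obj.obj (op U)

instance (E : 𝒪.Modules) (U : Opens X) : Ring (Sec E U) :=
  inferInstanceAs (Ring ((sheaf E).obj.obj (op U)))

/-- The canonical map `⋀_{𝒪(U)} E(U) → (⋀ E)(U)`. -/
def of (E : 𝒪.Modules) (U : Opens X) :
    ExteriorAlgebra (𝒪.Γ U) (OModule.Sec E U) →+* Sec E U :=
  ((toSheafify (Opens.grothendieckTopology X) (presheaf E)).app (op U)).hom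

/-- Restriction `(⋀ E)(U) → (⋀ E)(V)`. -/
def res (E : 𝒪.Modules) {U V : Opens X} (h : V ≤ U) : Sec E U →+* Sec E V :=
  ((sheaf E).obj.map (homOfLE h).op).hom

/-- The structure map `𝒪(U) → (⋀ E)(U)`. -/
def scalar (E : 𝒪.Modules) (U : Opens X) : 𝒪.Γ U →+* Sec E U :=
  (of E U).comp (algebraMap _ _)

/-- The canonical map `E(U) → (⋀ E)(U)`. -/
def ι (E : 𝒪.Modules) (U : Opens X) (D : OModule.Sec E U) : Sec E U :=
  of E U (ExteriorAlgebra.ι (𝒪.Γ U) D)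

instance (E : 𝒪.Modules) (U : Opens X) : Module (𝒪.Γ U) (Sec E U) :=
  Module.compHom (Sec E U) (scalar E U)

instance (E : 𝒪.Modules) (U : Opens X) : Module K (Sec E U) :=
  Module.compHom (Sec E U) (algebraMap K (𝒪.Γ U))

/-- The `ℤ`-grading of the exterior algebra of an `A`-module, zero in negative degrees. -/
def gr (A M : Type*) [CommRing A] [AddCommGroup M] [Module A M] :
    ℤ → Submodule A (ExteriorAlgebra A M)
  | Int.ofNat n => ⋀[A]^n M
  | Int.negSucc _ => ⊥

/-- `s` lies in the degree `n` part `⋀ⁿ E` of `⋀ E`, the sheafification of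
`U ↦ ⋀ⁿ_{𝒪(U)} E(U)`, i.e. `s` is locally the image of an element of degree `n`. -/
def IsHomog (E : 𝒪.Modules) {U : Opens X} (n : ℤ) (s : Sec E U) : Prop :=
  ∀ x ∈ U, ∃ (V : Opens X) (h : V ≤ U), x ∈ V ∧
    ∃ p ∈ gr (𝒪.Γ V) (OModule.Sec E V) n, of E V p = res E h s

end ExtAlg

variable {K : Type u} [Field K] [TopologicalSpace K] {X : TopCat.{u}} {𝒪 : TopRingedSpace K X}

/-- A Lie algebroid structure on an `𝒪`-module `E`, as a sheaf of Lie-Rinehart algebras. The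
anchor `E → Der_K(𝒪)` is given by the derivations `anchor U D` of `𝒪(U)`, for `D ∈ E(U)`; by
`anchor_res`, the derivations `anchor V (D|_V)` with `V ⊆ U` make up a section over `U` of the
sheaf of derivations of `𝒪`, and this section depends on `D` compatibly with restriction. -/
@[ext]
structure LieAlgebroid (E : 𝒪.Modules) where
  /-- The Lie bracket, bilinear over `K`. -/
  bracket : ∀ U : Opens X, OModule.Sec E U →ₗ[K] OModule.Sec E U →ₗ[K] OModule.Sec E U
  /-- The anchor, linear over `𝒪`. -/
  anchor : ∀ U : Opens X, OModule.Sec E U →ₗ[𝒪.Γ U] Derivation K (𝒪.Γ U) (𝒪.Γ U)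
  bracket_res : ∀ {U V : Opens X} (h : V ≤ U) (D D' : OModule.Sec E U),
    OModule.res E h (bracket U D D') = bracket V (OModule.res E h D) (OModule.res E h D')
  anchor_res : ∀ {U V : Opens X} (h : V ≤ U) (D : OModule.Sec E U) (f : 𝒪.Γ U),
    𝒪.res h (anchor U D f) = anchor V (OModule.res E h D) (𝒪.res h f)
  bracket_self : ∀ (U : Opens X) (D : OModule.Sec E U), bracket U D D = 0
  jacobi : ∀ (U : Opens X) (D₁ D₂ D₃ : OModule.Sec E U),
    bracket U D₁ (bracket U D₂ D₃) =
      bracket U (bracket U D₁ D₂) D₃ + bracket U D₂ (bracket U D₁ D₃)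
  anchor_bracket : ∀ (U : Opens X) (D D' : OModule.Sec E U),
    anchor U (bracket U D D') = ⁅anchor U D, anchor U D'⁆
  leibniz : ∀ (U : Opens X) (D D' : OModule.Sec E U) (f : 𝒪.Γ U),
    bracket U D (f • D') = f • bracket U D D' + anchor U D f • D'

/-- A morphism of Lie algebroids. -/
structure LieAlgebroid.IsHom {E L : 𝒪.Modules} (ΛE : LieAlgebroid E) (ΛL : LieAlgebroid L)
    (φ : E ⟶ L) : Prop where
  map_bracket : ∀ (U : Opens X) (D D' : OModule.Sec E U),
    OModule.app φ U (ΛE.bracket U D D') =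
      ΛL.bracket U (OModule.app φ U D) (OModule.app φ U D')
  anchor_comp : ∀ (U : Opens X) (D : OModule.Sec E U),
    ΛL.anchor U (OModule.app φ U D) = ΛE.anchor U D

/-- An `L`-Lie algebroid structure on `E`: a Lie algebroid structure on `E` with a morphism of
Lie algebroids to `L`. -/
@[ext]
structure RootedLieAlgebroid (E : 𝒪.Modules) {L : 𝒪.Modules} (ΛL : LieAlgebroid L) where
  str : LieAlgebroid E
  hom : E ⟶ L
  isHom : str.IsHom ΛL hom

/-- A Gerstenhaber algebra structure on `⋀ E`: a bracket on the graded commutative `𝒪`-algebra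
`⋀ E` that is a graded Lie bracket over `K` after the shift of degrees by one, and for which
`[a, ·]` is a derivation of degree `i - 1` of the exterior product if `a` has degree `i`. -/
@[ext]
structure Gerstenhaber (E : 𝒪.Modules) where
  /-- The Gerstenhaber bracket, bilinear over `K`. -/
  bracket : ∀ U : Opens X, ExtAlg.Sec E U →ₗ[K] ExtAlg.Sec E U →ₗ[K] ExtAlg.Sec E U
  bracket_res : ∀ {U V : Opens X} (h : V ≤ U) (a b : ExtAlg.Sec E U),
    ExtAlg.res E h (bracket U a b) = bracket V (ExtAlg.res E h a) (ExtAlg.res E h b)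
  bracket_homog : ∀ (U : Opens X) (i j : ℤ) (a b : ExtAlg.Sec E U),
    ExtAlg.IsHomog E i a → ExtAlg.IsHomog E j b → ExtAlg.IsHomog E (i + j - 1) (bracket U a b)
  bracket_symm : ∀ (U : Opens X) (i j : ℤ) (a b : ExtAlg.Sec E U),
    ExtAlg.IsHomog E i a → ExtAlg.IsHomog E j b →
    bracket U a b = -(((i - 1) * (j - 1)).negOnePow • bracket U b a)
  jacobi : ∀ (U : Opens X) (i j : ℤ) (a b c : ExtAlg.Sec E U),
    ExtAlg.IsHomog E i a → ExtAlg.IsHomog E j b →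
    bracket U a (bracket U b c) =
      bracket U (bracket U a b) c + ((i - 1) * (j - 1)).negOnePow • bracket U b (bracket U a c)
  leibniz : ∀ (U : Opens X) (i j : ℤ) (a b c : ExtAlg.Sec E U),
    ExtAlg.IsHomog E i a → ExtAlg.IsHomog E j b →
    bracket U a (b * c) = bracket U a b * c + ((i - 1) * j).negOnePow • (b * bracket U a c)

/-- A homomorphism of graded `𝒪`-algebras `⋀ E → ⋀ L`. -/
@[ext]
structure ExtAlg.Hom (E L : 𝒪.Modules) where
  app : ∀ U : Opens X, ExtAlg.Sec E U →+* ExtAlg.Sec L U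
  app_res : ∀ {U V : Opens X} (h : V ≤ U) (a : ExtAlg.Sec E U),
    ExtAlg.res L h (app U a) = app V (ExtAlg.res E h a)
  app_scalar : ∀ (U : Opens X) (f : 𝒪.Γ U), app U (ExtAlg.scalar E U f) = ExtAlg.scalar L U f
  app_homog : ∀ (U : Opens X) (n : ℤ) (a : ExtAlg.Sec E U),
    ExtAlg.IsHomog E n a → ExtAlg.IsHomog L n (app U a)

/-- A `G`-Gerstenhaber algebra structure on `⋀ E`, where `G` is a Gerstenhaber algebra structure
on `⋀ L`: a Gerstenhaber algebra structure on `⋀ E` with a morphism of Gerstenhaber algebras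
to `(⋀ L, G)`. -/
@[ext]
structure RootedGerstenhaber (E : 𝒪.Modules) {L : 𝒪.Modules} (G : Gerstenhaber L) where
  str : Gerstenhaber E
  hom : ExtAlg.Hom E L
  map_bracket : ∀ (U : Opens X) (a b : ExtAlg.Sec E U),
    hom.app U (str.bracket U a b) = G.bracket U (hom.app U a) (hom.app U b)

/-- `G` is the standard Gerstenhaber algebra `𝒢_L` of the Lie algebroid `L`: its bracket is the
generalised Schouten-Nijenhuis bracket, that is, `[D, f] = 𝔞(D)(f)` and
`[D_0 ∧ ⋯ ∧ D_m, F_0 ∧ ⋯ ∧ F_n]` is the sum over `i ≤ m` and `j ≤ n` of `(-1)^(i+j)` times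
`[D_i, F_j] ∧ (D_0 ∧ ⋯ ∧ D_m without D_i) ∧ (F_0 ∧ ⋯ ∧ F_n without F_j)`. -/
structure Gerstenhaber.IsStandard {L : 𝒪.Modules} (G : Gerstenhaber L)
    (Λ : LieAlgebroid L) : Prop where
  bracket_scalar : ∀ (U : Opens X) (D : OModule.Sec L U) (f : 𝒪.Γ U),
    G.bracket U (ExtAlg.ι L U D) (ExtAlg.scalar L U f) = ExtAlg.scalar L U (Λ.anchor U D f)
  bracket_wedge : ∀ (U : Opens X) (m n : ℕ) (D : Fin (m + 1) → OModule.Sec L U)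
    (F : Fin (n + 1) → OModule.Sec L U),
    G.bracket U (ExtAlg.of L U (ExteriorAlgebra.ιMulti (𝒪.Γ U) (m + 1) D))
        (ExtAlg.of L U (ExteriorAlgebra.ιMulti (𝒪.Γ U) (n + 1) F)) =
      ∑ i : Fin (m + 1), ∑ j : Fin (n + 1), (-1) ^ (i.1 + j.1) *
        (ExtAlg.ι L U (Λ.bracket U (D i) (F j)) *
          ExtAlg.of L U (ExteriorAlgebra.ιMulti (𝒪.Γ U) m (i.removeNth D)) *
          ExtAlg.of L U (ExteriorAlgebra.ιMulti (𝒪.Γ U) n (j.removeNth F)))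

/-- The `𝒢_L`-Gerstenhaber algebra structure `S` on `⋀ E` restricts in degrees `0` and `1` to the
`L`-Lie algebroid structure `T` on `E`. -/
structure RestrictsTo {E L : 𝒪.Modules} {G : Gerstenhaber L} {ΛL : LieAlgebroid L}
    (S : RootedGerstenhaber E G) (T : RootedLieAlgebroid E ΛL) : Prop where
  bracket : ∀ (U : Opens X) (D D' : OModule.Sec E U),
    S.str.bracket U (ExtAlg.ι E U D) (ExtAlg.ι E U D') = ExtAlg.ι E U (T.str.bracket U D D')
  anchor : ∀ (U : Opens X) (D : OModule.Sec E U) (f : 𝒪.Γ U),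
    S.str.bracket U (ExtAlg.ι E U D) (ExtAlg.scalar E U f) =
      ExtAlg.scalar E U (T.str.anchor U D f)
  hom : ∀ (U : Opens X) (D : OModule.Sec E U),
    S.hom.app U (ExtAlg.ι E U D) = ExtAlg.ι L U (OModule.app T.hom U D)

end

/-! A Gerstenhaber bracket is, up to signs, a derivation in each argument, so it is determined by
its values on functions and on sections of the module. For degree reasons `[f, g]` vanishes, `[D,
f]` is a function and `[D, D']` is a section of the module. The last two operations are the anchor
and the Lie bracket, and the Gerstenhaber axioms in these degrees are the Lie algebroid axioms. What
needs work is the extension of a Lie algebroid structure to the whole exterior algebra.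

Over one open set this concerns a Lie-Rinehart algebra `(A, M)` with 2 invertible in `A`.
Antisymmetry forces `[a, D] = -L_D a` and `[a, f] = ± i_{df} a`, with the Lie derivative `L_D`
(`lieDer`) and the contraction `i_{df}` (`contr`). This prescribes `[a, ·]` on generators. A skew
derivation with prescribed values on generators is the corner entry of a ring homomorphism into
upper triangular matrices (`exists_skewDer`); the consistency condition on `f • D` is the Cartan
formula `L_{fD} = f L_D - D ∧ i_{df}` (`lieDer_smul_left`). Skew derivations that agree on
generators are equal (`ext_skewDer`), which reduces the Leibniz rule on the left, the Jacobi
identity and functoriality to Cartan formulas.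

Functoriality (`IsSchouten.map_bracket`) makes the brackets compatible with restriction, so they
pass to the sheafification (`exists_extend₂`). Conversely, the parts of degree 0 and 1 of the
sheafified exterior algebra are the structure sheaf and the module themselves
(`exists_scalar_of_isHomog`, `exists_ι_of_isHomog`), so brackets and morphisms restrict. Uniqueness,
and the fact that induced morphisms preserve brackets, both follow from `map_bracket_of_generators`.
-/

/-! ### Parity and skew derivations on an exterior algebra. -/

/-- A skew derivation `d` along the ring homomorphisms `f` and `g`:
`d (x y) = d x * f y + g x * d y`. -/
def IsSkewDer {B C : Type*} [Ring B] [Ring C] (f g : B →+* C) (d : B → C) : Prop :=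
  ∀ x y, d (x * y) = d x * f y + g x * d y

/-- The sign `(-1)^i` of a parity `i`. -/
def paritySign (i : ZMod 2) : ℤˣ := if i = 0 then 1 else -1

@[simp] theorem paritySign_zero : paritySign 0 = 1 := rfl

@[simp] theorem paritySign_one : paritySign 1 = -1 := rfl

theorem ZMod.eq_zero_or_one_of_two (i : ZMod 2) : i = 0 ∨ i = 1 := by
  revert i; decide

theorem ZMod.one_add_one_of_two : (1 + 1 : ZMod 2) = 0 := rfl

theorem Int.negOnePow_eq_paritySign (n : ℤ) : n.negOnePow = paritySign (n : ZMod 2) := by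
  rcases Int.even_or_odd n with h | h
  · rw [Int.negOnePow_even n h, (ZMod.intCast_eq_zero_iff_even).2 h, paritySign_zero]
  · rw [Int.negOnePow_odd n h, (ZMod.intCast_eq_one_iff_odd).2 h, paritySign_one]

theorem paritySign_add (i j : ZMod 2) : paritySign (i + j) = paritySign i * paritySign j := by
  revert i j; decide

namespace ExteriorAlgebra

variable {A M : Type*} [CommRing A] [AddCommGroup M] [Module A M]

local notation "B" => ExteriorAlgebra A M

/-- The image of `A` need not be central in `T`, so the universal property does not apply to `T`
itself. It applies to the centralizer of `g(A)`, which is an `A`-algebra and contains `h(M)` by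
`hcomm`. -/
theorem exists_ringHom {T : Type*} [Ring T] (g : A →+* T) (h : M →+ T)
    (hsmul : ∀ f D, h (f • D) = g f * h D) (hcomm : ∀ f D, g f * h D = h D * g f)
    (hsq : ∀ D, h D * h D = 0) :
    ∃ Φ : B →+* T, (∀ f, Φ (algebraMap A B f) = g f) ∧ ∀ D, Φ (ι A D) = h D := by
  let T' := Subring.centralizer (Set.range g)
  have hg : ∀ f, g f ∈ T' := by
    rintro f _ ⟨f', rfl⟩
    rw [← map_mul, ← map_mul, mul_comm]
  have hh : ∀ D, h D ∈ T' := by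
    rintro D _ ⟨f, rfl⟩
    exact hcomm f D
  let gT : A →+* T' := g.codRestrict T' hg
  let _ : Algebra A T' := gT.toAlgebra' fun c x => Subtype.ext (x.2 _ ⟨c, rfl⟩)
  let l : B →ₐ[A] T' := ExteriorAlgebra.lift A
    ⟨{ toFun := fun D => ⟨h D, hh D⟩
       map_add' := fun D D' => Subtype.ext (map_add h D D')
       map_smul' := fun f D => Subtype.ext (hsmul f D) },
      fun D => Subtype.ext (hsq D)⟩
  refine ⟨T'.subtype.comp l.toRingHom, fun f => ?_, fun D => ?_⟩
  · exact congrArg Subtype.val (l.commutes f)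
  · exact congrArg Subtype.val (ExteriorAlgebra.lift_ι_apply A _ _ D)

/-- The automorphism `x ↦ (-1)^(i |x|) x` of the exterior algebra. -/
def twist (i : ZMod 2) : ExteriorAlgebra A M →ₐ[A] ExteriorAlgebra A M :=
  if i = 0 then AlgHom.id A _ else CliffordAlgebra.involute (Q := (0 : QuadraticForm A M))

@[simp] theorem twist_zero (x : B) : twist (A := A) 0 x = x := rfl

theorem twist_ι (i : ZMod 2) (D : M) : twist i (ι A D) = paritySign i • ι A D := by
  obtain rfl | rfl := i.eq_zero_or_one_of_two
  · simp
  · rw [paritySign_one, Units.neg_smul, one_smul]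
    exact CliffordAlgebra.involute_ι (Q := (0 : QuadraticForm A M)) D

@[simp] theorem twist_one_ι (D : M) : twist 1 (ι A D) = -ι A D := by
  simp [twist_ι]

theorem twist_twist (i j : ZMod 2) (x : B) : twist i (twist j x) = twist (i + j) x := by
  obtain rfl | rfl := i.eq_zero_or_one_of_two
  · simp
  obtain rfl | rfl := j.eq_zero_or_one_of_two
  · simp
  · exact CliffordAlgebra.involute_involute x

@[simp] theorem twist_one_one (x : B) : twist 1 (twist 1 x) = x := twist_twist 1 1 x

/-- `x` is homogeneous of parity `i`. -/
def IsPar (i : ZMod 2) (x : B) : Prop := twist 1 x = paritySign i • x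

theorem IsPar.twist_eq {i : ZMod 2} {x : B} (hx : IsPar i x) (j : ZMod 2) :
    twist j x = paritySign (j * i) • x := by
  obtain rfl | rfl := j.eq_zero_or_one_of_two
  · simp
  · rw [one_mul]; exact hx

theorem isPar_algebraMap (f : A) : IsPar 0 (algebraMap A B f) := by
  simp [IsPar]

theorem isPar_ι (D : M) : IsPar 1 (ι A D) := by
  simp [IsPar]

theorem IsPar.mul {i j : ZMod 2} {x y : B} (hx : IsPar i x) (hy : IsPar j y) :
    IsPar (i + j) (x * y) := by
  unfold IsPar at *
  rw [map_mul, hx, hy, paritySign_add, smul_mul_smul_comm]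

theorem IsPar.add {i : ZMod 2} {x y : B} (hx : IsPar i x) (hy : IsPar i y) :
    IsPar i (x + y) := by
  unfold IsPar at *
  rw [map_add, hx, hy, smul_add]

theorem IsPar.twist {i : ZMod 2} {x : B} (hx : IsPar i x) (j : ZMod 2) :
    IsPar i (twist j x) := by
  obtain rfl | rfl := j.eq_zero_or_one_of_two
  · simpa
  obtain rfl | rfl := i.eq_zero_or_one_of_two <;> simp_all [IsPar]

/-- Every element is the sum of an even and an odd one. -/
theorem isPar_induction (h2 : IsUnit (2 : A)) {P : B → Prop}
    (hadd : ∀ x y, P x → P y → P (x + y)) (hpar : ∀ i x, IsPar i x → P x) (x : B) : P x := by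
  obtain ⟨u, hu⟩ := h2
  set c : A := ((u⁻¹ : Aˣ) : A)
  have hc : c + c = 1 := by
    rw [← two_mul, ← hu]; exact u.mul_inv
  have : x = c • (x + twist 1 x) + c • (x - twist 1 x) := by
    rw [smul_add, smul_sub, add_add_sub_cancel, ← add_smul, hc, one_smul]
  rw [this]
  refine hadd _ _ (hpar 0 _ ?_) (hpar 1 _ ?_)
  · simp [IsPar, add_comm]
  · simp [IsPar, ← smul_neg]

theorem mul_ι_eq (x : B) (D : M) : x * ι A D = ι A D * twist 1 x := by
  induction x using ExteriorAlgebra.induction with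
  | algebraMap r => simp [Algebra.commutes]
  | ι y =>
    rw [twist_one_ι, mul_neg, eq_neg_iff_add_eq_zero]
    exact ExteriorAlgebra.ι_add_mul_swap y D
  | mul a b ha hb => rw [map_mul, mul_assoc, hb, ← mul_assoc, ha, mul_assoc]
  | add a b ha hb => rw [map_add, mul_add, add_mul, ha, hb]

theorem ι_mul_eq (x : B) (D : M) : ι A D * x = twist 1 x * ι A D := by
  rw [mul_ι_eq, twist_one_one]

/-- Graded commutativity with the sign absorbed into `twist i`, so that `x` need not be homogeneous.
Both sides respect sums and products in `x`, which leaves the generators. -/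
theorem IsPar.mul_eq {i : ZMod 2} {a : B} (ha : IsPar i a) (x : B) :
    a * x = ExteriorAlgebra.twist i x * a := by
  induction x using ExteriorAlgebra.induction with
  | algebraMap r => simp [Algebra.commutes]
  | ι y => rw [mul_ι_eq, ha, twist_ι, mul_smul_comm, smul_mul_assoc]
  | mul x y hx hy => rw [map_mul, ← mul_assoc, hx, mul_assoc, hy, mul_assoc]
  | add x y hx hy => rw [map_add, mul_add, add_mul, hx, hy]

section SkewDer

variable {C : Type*} [Ring C]

/-- The ring homomorphisms `f` and `g` are arbitrary so that the lemma also covers composites of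
derivations with twists and with maps to another exterior algebra. -/
theorem ext_skewDer {f g : B →+* C} {d d' : B → C} (hadd : ∀ x y, d (x + y) = d x + d y)
    (hadd' : ∀ x y, d' (x + y) = d' x + d' y) (hd : IsSkewDer f g d)
    (hd' : IsSkewDer f g d') (h0 : ∀ r, d (algebraMap A B r) = d' (algebraMap A B r))
    (h1 : ∀ D, d (ι A D) = d' (ι A D)) (x : B) : d x = d' x := by
  induction x using ExteriorAlgebra.induction with
  | algebraMap r => exact h0 r
  | ι y => exact h1 y
  | mul x y hx hy => rw [hd, hd', hx, hy]
  | add x y hx hy => rw [hadd, hadd', hx, hy]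

/-- A skew derivation of the exterior algebra exists for given values on generators. -/
theorem exists_skewDer (i : ZMod 2) (α : A →+ B) (β : M →+ B)
    (hα : ∀ f g, α (f * g) = f • α g + g • α f)
    (hc : ∀ f D, α f * ι A D = twist i (ι A D) * α f)
    (hβ : ∀ f D, β (f • D) = f • β D + α f * ι A D)
    (hsq : ∀ D, β D * ι A D + twist i (ι A D) * β D = 0) :
    ∃ d : B →+ B, IsSkewDer (RingHom.id B) (twist i : B →ₐ[A] B).toRingHom d ∧
      (∀ f, d (algebraMap A B f) = α f) ∧ ∀ D, d (ι A D) = β D := by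
  have hα1 : α 1 = 0 := by simpa using hα 1 1
  -- The matrix `!![twist i x, d x; 0, x]` is multiplicative in `x` exactly when `d` is a skew
  -- derivation along `id` and `twist i`. The hypotheses `hα`, `hβ`, `hc`, `hsq` are the conditions
  -- on the corner entry needed for such a homomorphism on generators.
  let g : A →+* Matrix (Fin 2) (Fin 2) B :=
    { toFun := fun f => !![algebraMap A B f, α f; 0, algebraMap A B f]
      map_one' := by simp [hα1, Matrix.one_fin_two]
      map_zero' := by ext p q; fin_cases p <;> fin_cases q <;> simp
      map_mul' := fun f f' => by
        ext p q; fin_cases p <;> fin_cases q <;>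
          simp [hα, Matrix.mul_apply, Algebra.smul_def, ← Algebra.commutes f' (α f)]
      map_add' := fun f f' => by ext p q; fin_cases p <;> fin_cases q <;> simp }
  let h : M →+ Matrix (Fin 2) (Fin 2) B :=
    { toFun := fun D => !![twist i (ι A D), β D; 0, ι A D]
      map_zero' := by ext p q; fin_cases p <;> fin_cases q <;> simp
      map_add' := fun f f' => by ext p q; fin_cases p <;> fin_cases q <;> simp }
  obtain ⟨Φ, hΦ0, hΦ1⟩ := exists_ringHom g h
    (fun f D => by
      ext p q; fin_cases p <;> fin_cases q <;> simp [g, h, hβ, Matrix.mul_apply, Algebra.smul_def])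
    (fun f D => by
      have h1 := Algebra.commutes f (β D)
      have h2 := Algebra.commutes f (ι A D)
      have h3 := Algebra.commutes f (twist i (ι A D))
      ext p q; fin_cases p <;> fin_cases q <;>
        simp [g, h, ← hc, Matrix.mul_apply, h1, h2, h3, add_comm])
    (fun D => by
      have : twist i (ι A D) * twist i (ι A D) = 0 := by
        rw [← map_mul, ExteriorAlgebra.ι_sq_zero, map_zero]
      have h' := hsq D
      rw [add_comm] at h'
      ext p q; fin_cases p <;> fin_cases q <;> simp [h, this, h', Matrix.mul_apply])
  have h00 : ∀ x, Φ x 0 0 = twist i x ∧ Φ x 1 0 = 0 ∧ Φ x 1 1 = x := fun x => by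
    induction x using ExteriorAlgebra.induction with
    | algebraMap r => simp [hΦ0, g]
    | ι y => simp [hΦ1, h]
    | mul x y hx hy => simp [Matrix.mul_apply, hx, hy]
    | add x y hx hy => simp [hx, hy]
  refine ⟨⟨⟨fun x => Φ x 0 1, by simp⟩, by simp⟩, fun x y => ?_, fun f => ?_, fun D => ?_⟩
  · simp [Matrix.mul_apply, h00, add_comm]
  · simp [hΦ0, g]
  · simp [hΦ1, h]

end SkewDer

open CliffordAlgebra in
theorem isSkewDer_contractLeft (d : Module.Dual A M) :
    IsSkewDer (RingHom.id B) (twist 1 : B →ₐ[A] B).toRingHom (contractLeft (Q := 0) d) := by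
  intro x y
  induction x using CliffordAlgebra.left_induction with
  | algebraMap r =>
    rw [contractLeft_algebraMap_mul, contractLeft_algebraMap]
    simp
  | add x y hx hy => simp only [add_mul, map_add, hx, hy]; abel
  | ι_mul x m hx =>
    have : twist (A := A) 1 (CliffordAlgebra.ι (0 : QuadraticForm A M) m) =
      -CliffordAlgebra.ι (0 : QuadraticForm A M) m := twist_one_ι m
    rw [mul_assoc, contractLeft_ι_mul, contractLeft_ι_mul, hx]
    simp [this, mul_add, sub_mul, mul_assoc]
    abel

end ExteriorAlgebra

/-! ### Cartan calculus of a Lie-Rinehart algebra. -/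

/-- A Lie-Rinehart algebra structure over `K` on a module `M` over a commutative
`K`-algebra `A`. -/
structure LieRinehartStr (K A M : Type*) [CommRing K] [CommRing A] [Algebra K A]
    [AddCommGroup M] [Module A M] where
  bracket : M →+ M →+ M
  anchor : M →ₗ[A] Derivation K A A
  bracket_self : ∀ D, bracket D D = 0
  jacobi : ∀ D₁ D₂ D₃,
    bracket D₁ (bracket D₂ D₃) = bracket (bracket D₁ D₂) D₃ + bracket D₂ (bracket D₁ D₃)
  anchor_bracket : ∀ D D', anchor (bracket D D') = ⁅anchor D, anchor D'⁆
  leibniz : ∀ (D D' : M) (f : A), bracket D (f • D') = f • bracket D D' + anchor D f • D'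

namespace LieRinehartStr

variable {K A M : Type*} [CommRing K] [CommRing A] [Algebra K A] [AddCommGroup M] [Module A M]
  (R : LieRinehartStr K A M)

local notation "B" => ExteriorAlgebra A M

open ExteriorAlgebra

theorem bracket_symm (D D' : M) : R.bracket D D' = -R.bracket D' D := by
  have h := R.bracket_self (D + D')
  simp only [map_add, AddMonoidHom.add_apply, R.bracket_self, zero_add, add_zero] at h
  exact eq_neg_of_add_eq_zero_right h

theorem leibniz_left (D D' : M) (f : A) :
    R.bracket (f • D) D' = f • R.bracket D D' - R.anchor D' f • D := by
  rw [R.bracket_symm, R.leibniz, R.bracket_symm D D']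
  module

theorem exists_lieDer (D : M) : ∃ d : B →+ B,
    IsSkewDer (RingHom.id B) (twist 0 : B →ₐ[A] B).toRingHom d ∧
      (∀ f, d (algebraMap A B f) = algebraMap A B (R.anchor D f)) ∧
      ∀ D', d (ι A D') = ι A (R.bracket D D') :=
  exists_skewDer 0
    ((algebraMap A B).toAddMonoidHom.comp (R.anchor D).toLinearMap.toAddMonoidHom)
    ((ι A).toAddMonoidHom.comp (R.bracket D))
    (fun f g => by simp [Algebra.smul_def])
    (fun f D => by simp [Algebra.commutes])
    (fun f D => by simp [R.leibniz, Algebra.smul_def])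
    (fun D => ι_add_mul_swap _ _)

/-- The Lie derivative along `D` on the exterior algebra. -/
noncomputable def lieDer (D : M) : ExteriorAlgebra A M →+ ExteriorAlgebra A M :=
  (R.exists_lieDer D).choose

theorem lieDer_mul (D : M) (x y : B) :
    R.lieDer D (x * y) = R.lieDer D x * y + x * R.lieDer D y :=
  (R.exists_lieDer D).choose_spec.1 x y

@[simp] theorem lieDer_algebraMap (D : M) (f : A) :
    R.lieDer D (algebraMap A B f) = algebraMap A B (R.anchor D f) :=
  (R.exists_lieDer D).choose_spec.2.1 f

@[simp] theorem lieDer_ι (D D' : M) : R.lieDer D (ι A D') = ι A (R.bracket D D') :=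
  (R.exists_lieDer D).choose_spec.2.2 D'

/-- The differential of `f`, as a linear form on `M`. -/
def differential (f : A) : Module.Dual A M where
  toFun D := R.anchor D f
  map_add' D D' := by simp
  map_smul' g D := by simp

/-- The contraction with the differential of `f`. -/
noncomputable def contr (f : A) : ExteriorAlgebra A M →ₗ[A] ExteriorAlgebra A M :=
  CliffordAlgebra.contractLeft (Q := 0) (R.differential f)

theorem contr_mul (f : A) (x y : B) :
    R.contr f (x * y) = R.contr f x * y + twist 1 x * R.contr f y :=
  isSkewDer_contractLeft _ x y

@[simp] theorem contr_algebraMap (f g : A) : R.contr f (algebraMap A B g) = 0 :=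
  CliffordAlgebra.contractLeft_algebraMap _ _ _

@[simp] theorem contr_ι (f : A) (D : M) :
    R.contr f (ι A D) = algebraMap A B (R.anchor D f) :=
  CliffordAlgebra.contractLeft_ι _ _ _

theorem contr_contr (f g : A) (x : B) : R.contr f (R.contr g x) = -R.contr g (R.contr f x) :=
  CliffordAlgebra.contractLeft_comm _ _ _

theorem contr_add (f g : A) (x : B) : R.contr (f + g) x = R.contr f x + R.contr g x := by
  have : R.differential (f + g) = R.differential f + R.differential g := by
    ext D; simp [differential]
  simp [contr, this]

theorem contr_mul_left (f g : A) (x : B) :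
    R.contr (f * g) x = f • R.contr g x + g • R.contr f x := by
  have : R.differential (f * g) = f • R.differential g + g • R.differential f := by
    ext D; simp [differential]
  simp [contr, this]

theorem contr_algebraMap_left (c : K) (x : B) : R.contr (algebraMap K A c) x = 0 := by
  have : R.differential (algebraMap K A c) = 0 := by
    ext D; simp [differential]
  simp [contr, this]

theorem lieDer_twist (D : M) (x : B) : R.lieDer D (twist 1 x) = twist 1 (R.lieDer D x) := by
  refine ext_skewDer (d := fun x => R.lieDer D (twist 1 x)) (d' := fun x => twist 1 (R.lieDer D x))
    (f := (twist 1 : B →ₐ[A] B).toRingHom) (g := (twist 1 : B →ₐ[A] B).toRingHom)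
    (by simp) (by simp) (fun x y => by simp [lieDer_mul]) (fun x y => by simp [lieDer_mul])
    (by simp) (by simp) x

/-- Contraction is odd, hence anticommutes with the parity automorphism. Precomposing with `twist 1`
turns it into a skew derivation along `twist 1` and the identity. -/
theorem contr_twist (f : A) (x : B) : R.contr f (twist 1 x) = -twist 1 (R.contr f x) := by
  refine ext_skewDer (d := fun x => R.contr f (twist 1 x)) (d' := fun x => -twist 1 (R.contr f x))
    (f := (twist 1 : B →ₐ[A] B).toRingHom) (g := RingHom.id B)
    (by simp) (by simp [add_comm]) (fun x y => by simp [contr_mul])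
    (fun x y => by simp [contr_mul, add_comm])
    (by simp) (by simp) x

theorem isPar_lieDer {i : ZMod 2} {x : B} (hx : IsPar i x) (D : M) : IsPar i (R.lieDer D x) := by
  unfold IsPar at *
  rw [← lieDer_twist, hx]
  obtain rfl | rfl := i.eq_zero_or_one_of_two <;> simp

theorem isPar_contr {i : ZMod 2} {x : B} (hx : IsPar i x) (f : A) :
    IsPar (i + 1) (R.contr f x) := by
  unfold IsPar at *
  rw [← neg_neg (twist 1 (R.contr f x)), ← contr_twist, hx, paritySign_add]
  obtain rfl | rfl := i.eq_zero_or_one_of_two <;> simp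

theorem lieDer_add_left (D D' : M) (x : B) :
    R.lieDer (D + D') x = R.lieDer D x + R.lieDer D' x := by
  refine ext_skewDer (d' := fun x => R.lieDer D x + R.lieDer D' x)
    (f := RingHom.id B) (g := RingHom.id B)
    (by simp) (fun x y => by simp; abel) (fun x y => by simp [lieDer_mul])
    (fun x y => by simp [lieDer_mul, mul_add, add_mul]; abel)
    (by simp) (by simp) x

/-- The correction is a derivation without sign: moving `D` past `x` cancels the twist in the
Leibniz rule of the contraction. On `M` it is the anchor term of `leibniz_left`. This formula makes
the prescribed values `-L_D a` of the bracket consistent under `D ↦ f • D`. -/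
theorem lieDer_smul_left (f : A) (D : M) (x : B) :
    R.lieDer (f • D) x = f • R.lieDer D x - ι A D * R.contr f x := by
  refine ext_skewDer (d' := fun x => f • R.lieDer D x - ι A D * R.contr f x)
    (f := RingHom.id B) (g := RingHom.id B)
    (by simp) (fun x y => by simp [mul_add]; abel) (fun x y => by simp [lieDer_mul])
    (fun x y => ?_) (by simp [Algebra.smul_def]) (fun D' => ?_) x
  · have h1 : x * (f • R.lieDer D y) = f • (x * R.lieDer D y) := by rw [mul_smul_comm]
    have h2 : x * (ι A D * R.contr f y) = ι A D * (twist 1 x * R.contr f y) := by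
      rw [← mul_assoc, mul_ι_eq, mul_assoc]
    simp only [lieDer_mul, contr_mul, RingHom.id_apply, smul_add, mul_add, mul_sub, sub_mul, h1, h2,
      smul_mul_assoc, mul_assoc]
    abel
  · simp [leibniz_left, ← Algebra.commutes, Algebra.smul_def]

/-- A commutator of derivations is a derivation, so generators suffice. On functions the identity
says that the anchor preserves brackets, on `M` it is the Jacobi identity. -/
theorem lieDer_lieDer (D D' : M) (x : B) : R.lieDer D (R.lieDer D' x) =
    R.lieDer (R.bracket D D') x + R.lieDer D' (R.lieDer D x) := by
  rw [← sub_eq_iff_eq_add]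
  refine ext_skewDer (d := fun x => R.lieDer D (R.lieDer D' x) - R.lieDer D' (R.lieDer D x))
    (f := RingHom.id B) (g := RingHom.id B)
    (fun x y => by simp; abel) (by simp)
    (fun x y => by simp [lieDer_mul, mul_sub, sub_mul]; abel) (fun x y => by simp [lieDer_mul])
    (fun f => ?_) (fun D'' => ?_) x
  · simp [R.anchor_bracket, Derivation.commutator_apply]
  · simp [R.jacobi D D' D'']

theorem lieDer_contr (D : M) (f : A) (x : B) : R.lieDer D (R.contr f x) =
    R.contr (R.anchor D f) x + R.contr f (R.lieDer D x) := by
  rw [← sub_eq_iff_eq_add]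
  refine ext_skewDer (d := fun x => R.lieDer D (R.contr f x) - R.contr f (R.lieDer D x))
    (f := RingHom.id B) (g := (twist 1 : B →ₐ[A] B).toRingHom)
    (fun x y => by simp; abel) (by simp)
    (fun x y => by simp [lieDer_mul, contr_mul, mul_sub, sub_mul, lieDer_twist]; abel)
    (fun x y => by simp [contr_mul])
    (fun f => ?_) (fun D'' => ?_) x
  · simp
  · simp [R.anchor_bracket, Derivation.commutator_apply]

end LieRinehartStr

/-! ### The Schouten bracket. -/

namespace LieRinehartStr

variable {K A M : Type*} [CommRing K] [CommRing A] [Algebra K A] [AddCommGroup M] [Module A M]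
  (R : LieRinehartStr K A M)

local notation "B" => ExteriorAlgebra A M

open ExteriorAlgebra

/-- The values are forced by antisymmetry from `[D, a] = L_D a` and `[f, a] = -i_{df} a`; the
resulting sign `(-1)^(i-1)` in `[a, f]` is `twist 1` on the contraction, which has parity `i - 1`.
Consistency on `f • D` is `lieDer_smul_left`; the other conditions follow from graded commutativity
and `d(fg) = f dg + g df`. -/
theorem exists_bracket_of_isPar {i : ZMod 2} {a : B} (ha : IsPar i a) : ∃ d : B →+ B,
    IsSkewDer (RingHom.id B) (twist (i + 1) : B →ₐ[A] B).toRingHom d ∧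
      (∀ f, d (algebraMap A B f) = twist 1 (R.contr f a)) ∧
      ∀ D, d (ι A D) = -R.lieDer D a := by
  refine exists_skewDer (i + 1)
    ⟨⟨fun f => twist 1 (R.contr f a), by
      have := R.contr_algebraMap_left 0 a
      rw [map_zero] at this
      simp [this]⟩,
      fun f g => by simp [contr_add]⟩
    ⟨⟨fun D => -R.lieDer D a, ?_⟩, fun D D' => by simp [lieDer_add_left, add_comm]⟩
    (fun f g => by simp [contr_mul_left]) (fun f D => ?_) (fun f D => ?_) (fun D => ?_)
  · simpa using R.lieDer_smul_left 0 0 a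
  · exact IsPar.mul_eq ((R.isPar_contr ha f).twist 1) _
  · simp [lieDer_smul_left, mul_ι_eq, add_comm, sub_eq_add_neg]
  · simp only [AddMonoidHom.coe_mk, ZeroHom.coe_mk]
    have := (R.isPar_lieDer ha D).mul_eq (ι A D)
    rw [neg_mul, this, mul_neg]
    obtain rfl | rfl := i.eq_zero_or_one_of_two <;> simp [twist_ι, ZMod.one_add_one_of_two]

/-- The axioms that pin down the Schouten bracket on the exterior algebra. -/
structure IsSchouten (br : ExteriorAlgebra A M →+ ExteriorAlgebra A M →+ ExteriorAlgebra A M) :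
    Prop where
  skew : ∀ {i : ZMod 2} {a : ExteriorAlgebra A M}, IsPar i a →
    IsSkewDer (RingHom.id (ExteriorAlgebra A M))
      (twist (i + 1) : ExteriorAlgebra A M →ₐ[A] ExteriorAlgebra A M).toRingHom (br a)
  map_algebraMap : ∀ a f, br a (algebraMap A _ f) = twist 1 (R.contr f a)
  map_ι : ∀ a D, br a (ι A D) = -R.lieDer D a

/-- The sign in the Leibniz rule depends on the parity of the first argument, so the bracket is
built on the even and the odd component of `a` separately. Splitting `a` into these components
requires dividing by 2. -/
theorem exists_isSchouten (h2 : IsUnit (2 : A)) : ∃ br, R.IsSchouten br := by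
  obtain ⟨u, hu⟩ := h2
  set c : A := ((u⁻¹ : Aˣ) : A)
  have hc : c + c = 1 := by
    rw [← two_mul, ← hu]; exact u.mul_inv
  have hc2 (x : B) : c • (x + x) = x := by rw [← two_smul A, smul_smul, mul_two, hc, one_smul]
  let pr (i : ZMod 2) : B →+ B :=
    ⟨⟨fun a => c • (a + paritySign i • twist 1 a), by simp⟩,
      fun a b => by simp only [map_add, smul_add]; abel⟩
  have hpr (i a) : pr i a = c • (a + paritySign i • twist 1 a) := rfl
  have hpar (i a) : IsPar i (pr i a) := by
    obtain rfl | rfl := i.eq_zero_or_one_of_two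
    · simp [IsPar, hpr, add_comm]
    · simp [IsPar, hpr, ← smul_neg, add_comm]
  choose d hd0 hd1 hd2 using fun i a => R.exists_bracket_of_isPar (hpar i a)
  -- The derivations are chosen one by one, so additivity in `a` is not built in; it comes from
  -- uniqueness on generators.
  have hdadd (i a b x) : d i (a + b) x = d i a x + d i b x := by
    refine ext_skewDer (d' := fun x => d i a x + d i b x) (by simp)
      (fun x y => by simp; abel) (hd0 _ _) (fun x y => ?_) (fun f => ?_) (fun D => ?_) x
    · simp only [hd0 i a x y, hd0 i b x y, add_mul, mul_add]; abel
    · simp [hd1]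
    · simp [hd2]; abel
  -- For homogeneous `a` the component of the other parity is zero, and so is its derivation.
  have hd (i a) (ha : IsPar i a) (x) : d 0 a x + d 1 a x = d i a x := by
    have key (j) (hj : pr j a = 0) : d j a x = 0 := by
      refine ext_skewDer (d' := fun x => 0) (by simp) (by simp) (hd0 j a) (fun x y => by simp)
        (fun f => ?_) (fun D => ?_) x
      · simp [hd1, hj]
      · simp [hd2, hj]
    unfold IsPar at ha
    obtain rfl | rfl := i.eq_zero_or_one_of_two
    · rw [key 1 (by simp [hpr, ha]), add_zero]
    · rw [key 0 (by simp [hpr, ha]), zero_add]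
  have hsum (a) : pr 0 a + pr 1 a = a := by
    simp only [hpr, paritySign_zero, paritySign_one, one_smul, Units.neg_smul, ← smul_add]
    rw [add_add_add_comm, add_neg_cancel, add_zero, hc2]
  refine ⟨⟨⟨fun a => d 0 a + d 1 a, ?_⟩, fun a b => ?_⟩, fun {i a} ha => ?_, fun a f => ?_,
    fun a D => ?_⟩
  · ext x
    have h0 := hdadd 0 0 0 x
    have h1 := hdadd 1 0 0 x
    simp only [add_zero, left_eq_add] at h0 h1
    simp [h0, h1]
  · ext x
    simp only [AddMonoidHom.add_apply, hdadd]
    abel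
  · have := hd0 i a
    have hb : ⇑(d 0 a + d 1 a) = d i a := funext fun x => hd i a ha x
    change IsSkewDer _ _ ⇑(d 0 a + d 1 a)
    rwa [hb]
  · simp [hd1, ← map_add, hsum]
  · simp only [AddMonoidHom.coe_mk, ZeroHom.coe_mk, AddMonoidHom.add_apply, hd2]
    rw [← neg_add, ← map_add, hsum]

namespace IsSchouten

variable {R} {br : ExteriorAlgebra A M →+ ExteriorAlgebra A M →+ ExteriorAlgebra A M}
  (h : R.IsSchouten br)
include h

theorem bracket_mul {i : ZMod 2} {a : B} (ha : IsPar i a) (x y : B) :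
    br a (x * y) = br a x * y + twist (i + 1) x * br a y :=
  h.skew ha x y

theorem ι_left (D : M) (x : B) : br (ι A D) x = R.lieDer D x :=
  ext_skewDer (d' := R.lieDer D) (by simp) (by simp) (h.skew (isPar_ι D))
    (fun x y => by simp [R.lieDer_mul, ZMod.one_add_one_of_two])
    (by simp [h.map_algebraMap]) (fun D' => by
      rw [h.map_ι, R.lieDer_ι, R.lieDer_ι, R.bracket_symm D D', map_neg]) x

theorem algebraMap_left (f : A) (x : B) :
    br (algebraMap A B f) x = -R.contr f x :=
  ext_skewDer (d' := fun x => -R.contr f x) (by simp) (by simp [add_comm])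
    (h.skew (isPar_algebraMap f))
    (fun x y => by simp [R.contr_mul, add_comm]) (by simp [h.map_algebraMap])
    (fun D => by simp [h.map_ι]) x

/-- Both sides are skew derivations in `x` along `twist (i + j + 1)`, so generators suffice.
Antisymmetry is not available here: its proof rests on this rule. -/
theorem mul_left_of_isPar {i j : ZMod 2} {a b : B} (ha : IsPar i a) (hb : IsPar j b) (x : B) :
    br (a * b) x = a * br b x + paritySign (i * j) • (b * br a x) := by
  refine ext_skewDer (d' := fun x => a * br b x + paritySign (i * j) • (b * br a x))
    (by simp) (fun x y => ?_) (h.skew (ha.mul hb)) (fun x y => ?_) (fun f => ?_) (fun D => ?_) x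
  · simp only [map_add, mul_add, smul_add]; abel
  · have h1 : a * (twist (j + 1) x * br b y) = twist (i + j + 1) x * (a * br b y) := by
      rw [← mul_assoc, ha.mul_eq, twist_twist, add_assoc, mul_assoc]
    have h2 : b * (twist (i + 1) x * br a y) = twist (i + j + 1) x * (b * br a y) := by
      rw [← mul_assoc, hb.mul_eq, twist_twist, add_left_comm, add_assoc, mul_assoc]
    beta_reduce
    rw [h.bracket_mul ha, h.bracket_mul hb]
    simp only [RingHom.id_apply, AlgHom.toRingHom_eq_coe, RingHom.coe_coe, mul_add, h1, h2, add_mul,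
      smul_add, smul_mul_assoc, mul_smul_comm, mul_assoc]
    abel
  · have h1 := ((R.isPar_contr ha f).twist 1).mul_eq b
    simp only [h.map_algebraMap, R.contr_mul, map_add, map_mul, twist_one_one, hb.twist_eq] at h1 ⊢
    rw [add_comm]
    congr 1
    obtain rfl | rfl := i.eq_zero_or_one_of_two <;>
    obtain rfl | rfl := j.eq_zero_or_one_of_two <;> simp_all [ZMod.one_add_one_of_two]
  · have h1 := (R.isPar_lieDer ha D).mul_eq b
    rw [hb.twist_eq] at h1
    simp only [h.map_ι, R.lieDer_mul, h1, smul_mul_assoc, mul_neg, smul_neg, neg_add]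
    rw [add_comm, mul_comm i j]

theorem ι_mul_left (h2 : IsUnit (2 : A)) (D : M) (a x : B) :
    br (ι A D * a) x =
      ι A D * br a x + twist 1 a * R.lieDer D x := by
  induction a using isPar_induction h2 with
  | hadd a b ha hb => simp only [mul_add, add_mul, map_add, AddMonoidHom.add_apply, ha, hb]; abel
  | hpar i a ha =>
    rw [h.mul_left_of_isPar (isPar_ι D) ha, h.ι_left D x, ha.twist_eq, smul_mul_assoc]

/-- For `a` of parity `i` the sign is `(-1)^(j + (j+1)i) = -(-1)^((i+1)(j+1))`, the usual one.
Written with `twist`, the identity is additive in `a` and can be proved by induction on left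
factors. -/
theorem symm (h2 : IsUnit (2 : A)) {j : ZMod 2} {b : B} (hb : IsPar j b) (a : B) :
    br a b = paritySign j • br b (twist (j + 1) a) := by
  induction a using CliffordAlgebra.left_induction with
  | algebraMap f =>
    change br (algebraMap A B f) b = paritySign j • br b (twist (j + 1) (algebraMap A B f))
    rw [h.algebraMap_left, AlgHom.commutes, h.map_algebraMap, R.isPar_contr hb, smul_smul,
      ← paritySign_add, ← add_assoc, CharTwo.add_self_eq_zero]
    simp
  | add x y hx hy => rw [map_add, map_add, map_add, AddMonoidHom.add_apply, hx, hy, smul_add]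
  | ι_mul x D hx =>
    have h1 := (R.isPar_lieDer hb D).mul_eq (twist (j + 1) x)
    rw [twist_twist, ← add_assoc, CharTwo.add_self_eq_zero, zero_add] at h1
    change br (ι A D * x) b =
      paritySign j • br b (twist (j + 1) (ι A D * x))
    rw [h.ι_mul_left h2, hx, map_mul, h.skew hb, ← h1]
    simp only [twist_ι, RingHom.id_apply, AlgHom.toRingHom_eq_coe, RingHom.coe_coe]
    obtain rfl | rfl := j.eq_zero_or_one_of_two <;>
      simp [h.map_ι, twist_ι, ZMod.one_add_one_of_two, add_comm]

/-- With `contr_bracket` below, this is the Jacobi identity with a generator as one of its entries,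
which is what the general Jacobi identity reduces to. -/
theorem lieDer_bracket (h2 : IsUnit (2 : A)) (D : M) (a b : B) :
    R.lieDer D (br a b) = br (R.lieDer D a) b + br a (R.lieDer D b) := by
  rw [← sub_eq_iff_eq_add]
  induction a using isPar_induction h2 with
  | hadd x y hx hy =>
    simp only [map_add, AddMonoidHom.add_apply, ← hx, ← hy]; abel
  | hpar i a ha =>
    refine ext_skewDer (d := fun b => R.lieDer D (br a b) - br a (R.lieDer D b))
      (fun x y => by simp; abel) (by simp) (fun x y => ?_) (h.skew (R.isPar_lieDer ha D))
      (fun f => ?_) (fun D' => ?_) b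
    · have hL : twist (i + 1) (R.lieDer D x) = R.lieDer D (twist (i + 1) x) := by
        obtain hi | hi := (i + 1).eq_zero_or_one_of_two <;> simp [hi, R.lieDer_twist]
      beta_reduce
      rw [h.bracket_mul ha, R.lieDer_mul, map_add, map_add, h.bracket_mul ha, h.bracket_mul ha]
      simp [R.lieDer_mul, hL, mul_sub, sub_mul]
      abel
    · simp [h.map_algebraMap, R.lieDer_twist, R.lieDer_contr]
    · simp [h.map_ι, R.lieDer_lieDer D D']

/-- The minus sign reflects that the bracket lowers the total degree by one. -/
theorem twist_bracket (h2 : IsUnit (2 : A)) (a b : B) :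
    twist 1 (br a b) = -br (twist 1 a) (twist 1 b) := by
  induction a using isPar_induction h2 with
  | hadd x y hx hy =>
    simp only [map_add, AddMonoidHom.add_apply, hx, hy]; abel
  | hpar i a ha =>
    have hi : 1 + (i + 1) = i + 1 + 1 := add_comm _ _
    refine ext_skewDer (d := fun b => twist 1 (br a b)) (d' := fun b => -br (twist 1 a) (twist 1 b))
      (f := (twist 1 : B →ₐ[A] B).toRingHom) (g := (twist (i + 1 + 1) : B →ₐ[A] B).toRingHom)
      (by simp) (fun x y => by simp; abel) (fun x y => ?_) (fun x y => ?_)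
      (fun g => ?_) (fun D' => ?_) b
    · simp [h.bracket_mul ha, twist_twist, hi]
    · simp [h.bracket_mul (ha.twist 1), twist_twist]
      abel
    · simp [h.map_algebraMap, R.contr_twist]
    · simp [h.map_ι, R.lieDer_twist]

theorem isPar_bracket (h2 : IsUnit (2 : A)) {i j : ZMod 2} {a b : B} (ha : IsPar i a)
    (hb : IsPar j b) : IsPar (i + j + 1) (br a b) := by
  unfold IsPar at *
  rw [h.twist_bracket h2, ha, hb]
  obtain rfl | rfl := i.eq_zero_or_one_of_two <;>
  obtain rfl | rfl := j.eq_zero_or_one_of_two <;> simp [ZMod.one_add_one_of_two]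

theorem twist_bracket_of_isPar (h2 : IsUnit (2 : A)) {i : ZMod 2} {a : B} (ha : IsPar i a)
    (j : ZMod 2) (b : B) :
    twist j (br a b) = paritySign (j * (i + 1)) • br a (twist j b) := by
  obtain rfl | rfl := j.eq_zero_or_one_of_two
  · simp
  rw [h.twist_bracket h2, ha]
  obtain rfl | rfl := i.eq_zero_or_one_of_two <;> simp [ZMod.one_add_one_of_two]

theorem contr_bracket (h2 : IsUnit (2 : A)) (f : A) (a b : B) :
    R.contr f (br a b) = br (R.contr f a) b - br (twist 1 a) (R.contr f b) := by
  rw [eq_sub_iff_add_eq]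
  induction a using isPar_induction h2 with
  | hadd x y hx hy =>
    simp only [map_add, AddMonoidHom.add_apply, ← hx, ← hy]; abel
  | hpar i a ha =>
    refine ext_skewDer (d := fun b => R.contr f (br a b) + br (twist 1 a) (R.contr f b))
      (fun x y => by simp; abel) (by simp) (fun x y => ?_) (h.skew (R.isPar_contr ha f))
      (fun g => ?_) (fun D' => ?_) b
    · beta_reduce
      rw [h.bracket_mul ha, R.contr_mul, map_add, map_add, h.bracket_mul (ha.twist 1),
        h.bracket_mul (ha.twist 1), ha]
      simp only [R.contr_mul, RingHom.id_apply, AlgHom.toRingHom_eq_coe, RingHom.coe_coe,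
        h.twist_bracket_of_isPar h2 ha]
      obtain rfl | rfl := i.eq_zero_or_one_of_two <;>
        simp [add_mul, mul_add, ZMod.one_add_one_of_two, R.contr_twist] <;> abel
    · simp [h.map_algebraMap, R.contr_twist, R.contr_contr f g]
    · simp [h.map_ι, R.lieDer_contr D', h.map_algebraMap, R.contr_twist]

/-- The graded commutator of two skew derivations is again one, along the composite of the twists;
its cross terms cancel. So it suffices to take `c` a generator, where `contr_bracket`,
`lieDer_bracket` and antisymmetry apply. -/
theorem jacobi (h2 : IsUnit (2 : A)) {i j : ZMod 2} {a b : B} (ha : IsPar i a) (hb : IsPar j b)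
    (c : B) :
    br a (br b c) = br (br a b) c + paritySign ((i + 1) * (j + 1)) • br b (br a c) := by
  rw [← sub_eq_iff_eq_add]
  refine ext_skewDer (d := fun c => br a (br b c) - paritySign ((i + 1) * (j + 1)) • br b (br a c))
      (fun x y => by simp; abel) (by simp) (fun x y => ?_) (h.skew (h.isPar_bracket h2 ha hb))
      (fun f => ?_) (fun D => ?_) c
  · have hij : i + j + 1 + 1 = i + 1 + (j + 1) := by ring
    simp only [h.bracket_mul ha, h.bracket_mul hb, map_add, h.twist_bracket_of_isPar h2 ha,
      h.twist_bracket_of_isPar h2 hb, twist_twist, RingHom.id_apply, AlgHom.toRingHom_eq_coe,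
      RingHom.coe_coe, hij, add_comm (j + 1) (i + 1)]
    rw [mul_comm (j + 1) (i + 1)]
    generalize paritySign ((i + 1) * (j + 1)) = ε
    rcases Int.units_eq_one_or ε with rfl | rfl <;>
      simp only [one_smul, Units.neg_smul, neg_mul, mul_add, add_mul, sub_mul, mul_sub,
        neg_add, neg_neg, sub_neg_eq_add] <;> abel
  · have hx := (R.isPar_contr ha f).twist 1
    have h1 := h.symm h2 hb (twist 1 (R.contr f a))
    rw [hx.twist_eq] at h1
    simp only [h.map_algebraMap, h.contr_bracket h2, map_sub, h.twist_bracket h2, twist_one_one,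
      sub_neg_eq_add, neg_add_eq_sub, sub_right_inj]
    unfold IsPar at hb
    rw [hb]
    obtain rfl | rfl := i.eq_zero_or_one_of_two <;>
    obtain rfl | rfl := j.eq_zero_or_one_of_two <;> simp_all [ZMod.one_add_one_of_two]
  · have h1 := h.symm h2 hb (R.lieDer D a)
    rw [(R.isPar_lieDer ha D).twist_eq] at h1
    simp only [h.map_ι, h.lieDer_bracket h2, h1, map_neg]
    obtain rfl | rfl := i.eq_zero_or_one_of_two <;>
    obtain rfl | rfl := j.eq_zero_or_one_of_two <;> simp [ZMod.one_add_one_of_two, add_comm]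
    abel

end IsSchouten
end LieRinehartStr

/-! ### The integer grading and the formula on decomposable elements. -/

namespace ExteriorAlgebra

variable {A M : Type*} [CommRing A] [AddCommGroup M] [Module A M]

open ExtAlg (gr)

theorem gr_natCast (n : ℕ) : gr A M n = ⋀[A]^n M := rfl

theorem gr_of_neg {n : ℤ} (hn : n < 0) : gr A M n = ⊥ := by
  obtain ⟨k, rfl⟩ := Int.eq_negSucc_of_lt_zero hn
  rfl

theorem algebraMap_mem_gr (f : A) : algebraMap A (ExteriorAlgebra A M) f ∈ gr A M 0 := by
  change _ ∈ gr A M ((0 : ℕ) : ℤ)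
  rw [gr_natCast, exteriorPower, pow_zero]
  exact Submodule.algebraMap_mem f

theorem ι_mul_mem_gr (D : M) {n : ℤ} {x : ExteriorAlgebra A M} (hx : x ∈ gr A M n) :
    ι A D * x ∈ gr A M (n + 1) := by
  obtain hn | hn := lt_or_ge n 0
  · rw [gr_of_neg hn, Submodule.mem_bot] at hx
    simp [hx]
  · lift n to ℕ using hn
    rw [← Nat.cast_succ, gr_natCast, exteriorPower, pow_succ']
    exact Submodule.mul_mem_mul (LinearMap.mem_range_self _ D) hx

theorem ι_mem_gr (D : M) : ι A D ∈ gr A M 1 := by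
  have := ι_mul_mem_gr D (algebraMap_mem_gr (A := A) (M := M) 1)
  rwa [zero_add, map_one, mul_one] at this

theorem gr_induction {P : ℤ → ExteriorAlgebra A M → Prop} (zero : ∀ n, P n 0)
    (add : ∀ n x y, P n x → P n y → P n (x + y)) (algebraMap : ∀ f, P 0 (algebraMap A _ f))
    (ι_mul : ∀ n D x, x ∈ gr A M n → P n x → P (n + 1) (ι A D * x)) {n : ℤ}
    {x : ExteriorAlgebra A M} (hx : x ∈ gr A M n) : P n x := by
  obtain hn | hn := lt_or_ge n 0
  · rw [gr_of_neg hn, Submodule.mem_bot] at hx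
    exact hx ▸ zero n
  · lift n to ℕ using hn
    induction n generalizing x with
    | zero =>
      rw [gr_natCast, exteriorPower, pow_zero] at hx
      obtain ⟨f, rfl⟩ := Submodule.mem_one.1 hx
      exact algebraMap f
    | succ n ih =>
      rw [gr_natCast, exteriorPower, pow_succ'] at hx
      refine Submodule.mul_induction_on hx ?_ fun x y => add _ x y
      rintro _ ⟨D, rfl⟩ y hy
      exact_mod_cast ι_mul n D y hy (ih hy)

theorem mul_mem_gr {i j : ℤ} {x y : ExteriorAlgebra A M} (hx : x ∈ gr A M i) (hy : y ∈ gr A M j) :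
    x * y ∈ gr A M (i + j) := by
  refine gr_induction (P := fun i x => x * y ∈ gr A M (i + j)) (fun n => by simp)
    (fun n x y hx hy => ?_) (fun f => ?_) (fun n D x _ hx => ?_) hx
  · rw [add_mul]; exact add_mem hx hy
  · rw [← Algebra.smul_def, zero_add]; exact Submodule.smul_mem _ _ hy
  · rw [mul_assoc, add_right_comm]; exact ι_mul_mem_gr D hx

theorem isPar_of_mem_gr {i : ℤ} {x : ExteriorAlgebra A M} (hx : x ∈ gr A M i) :
    IsPar (i : ZMod 2) x := by
  refine gr_induction (P := fun i x => IsPar (i : ZMod 2) x) (fun n => by simp [IsPar])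
    (fun n x y hx hy => hx.add hy) (fun f => by simpa using isPar_algebraMap f)
    (fun n D x _ hx => ?_) hx
  rw [Int.cast_add, Int.cast_one, add_comm]
  exact (isPar_ι D).mul hx

theorem neg_one_pow_smul_mem_gr {i : ℤ} {x : ExteriorAlgebra A M} (hx : x ∈ gr A M i) (ε : ℤˣ) :
    ε • x ∈ gr A M i := by
  obtain rfl | rfl := Int.units_eq_one_or ε
  · simpa
  · simpa using hx

theorem twist_one_ιMulti (n : ℕ) (D : Fin n → M) :
    twist 1 (ιMulti A n D) = (-1) ^ n * ιMulti A n D := by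
  induction n with
  | zero => simp
  | succ n ih =>
    rw [ιMulti_succ_apply, map_mul, ih, pow_succ]
    rcases neg_one_pow_eq_or (ExteriorAlgebra A M) n with h | h <;> simp [h]

theorem ιMulti_removeNth_succ {n : ℕ} (D : Fin (n + 2) → M) (i : Fin (n + 1)) :
    ιMulti A (n + 1) (i.succ.removeNth D) =
      ι A (D 0) * ιMulti A n (i.removeNth (Matrix.vecTail D)) := by
  rw [ιMulti_succ_apply]
  congr 2
  funext j
  simp [Matrix.vecTail, Fin.removeNth]

end ExteriorAlgebra

namespace LieRinehartStr

variable {K A M : Type*} [CommRing K] [CommRing A] [Algebra K A] [AddCommGroup M] [Module A M]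
  (R : LieRinehartStr K A M)

local notation "B" => ExteriorAlgebra A M

open ExteriorAlgebra
open ExtAlg (gr)

theorem lieDer_mem_gr (D : M) {n : ℤ} {x : B} (hx : x ∈ gr A M n) : R.lieDer D x ∈ gr A M n := by
  refine gr_induction (P := fun n x => R.lieDer D x ∈ gr A M n) (fun n => by simp)
    (fun n x y hx hy => ?_) (fun f => ?_) (fun n D' x hx hx' => ?_) hx
  · rw [map_add]; exact add_mem hx hy
  · rw [lieDer_algebraMap]; exact algebraMap_mem_gr _
  · rw [lieDer_mul, lieDer_ι]; exact add_mem (ι_mul_mem_gr _ hx) (ι_mul_mem_gr _ hx')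

theorem contr_mem_gr (f : A) {n : ℤ} {x : B} (hx : x ∈ gr A M n) :
    R.contr f x ∈ gr A M (n - 1) := by
  refine gr_induction (P := fun n x => R.contr f x ∈ gr A M (n - 1)) (fun n => by simp)
    (fun n x y hx hy => ?_) (fun f => ?_) (fun n D' x hx hx' => ?_) hx
  · rw [map_add]; exact add_mem hx hy
  · simp
  · rw [contr_mul, contr_ι, ← Algebra.smul_def, twist_one_ι, neg_mul]
    have := ι_mul_mem_gr D' hx'
    rw [add_sub_cancel_right]
    rw [sub_add_cancel] at this
    exact add_mem (Submodule.smul_mem _ _ hx) (neg_mem this)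

/-- The sign arises from moving `[D, F_j]` to the front past `j` factors. -/
theorem lieDer_ιMulti (D : M) (n : ℕ) (F : Fin (n + 1) → M) :
    R.lieDer D (ιMulti A (n + 1) F) =
      ∑ j : Fin (n + 1), (-1) ^ j.1 *
        (ι A (R.bracket D (F j)) * ιMulti A n (j.removeNth F)) := by
  induction n with
  | zero =>
    have : R.lieDer D (1 : B) = 0 := by simpa using R.lieDer_algebraMap D 1
    rw [ιMulti_succ_apply, lieDer_mul]
    simp [this]
  | succ n ih =>
    rw [ιMulti_succ_apply, lieDer_mul, ih, Fin.sum_univ_succ (n := n + 1), lieDer_ι, Finset.mul_sum]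
    congr 1
    · simp [Matrix.vecTail, Fin.removeNth_zero, Fin.tail_def, Function.comp_def]
    · refine Finset.sum_congr rfl fun j _ => ?_
      rw [ιMulti_removeNth_succ, ← mul_assoc (ι A (R.bracket D (F j.succ))), mul_ι_eq, twist_one_ι,
        Fin.val_succ, pow_succ]
      rcases neg_one_pow_eq_or B j.1 with h | h <;>
        simp [h, Matrix.vecTail, mul_assoc]

namespace IsSchouten

variable {R} {br : ExteriorAlgebra A M →+ ExteriorAlgebra A M →+ ExteriorAlgebra A M}
  (h : R.IsSchouten br)
include h

theorem bracket_scalar (a : B) (c : K) : br a (algebraMap A B (algebraMap K A c)) = 0 := by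
  rw [h.map_algebraMap, contr_algebraMap_left, map_zero]

theorem algebraMap_mul_left (h2 : IsUnit (2 : A)) (f : A) (a x : B) :
    br (algebraMap A B f * a) x = algebraMap A B f * br a x - a * R.contr f x := by
  induction a using isPar_induction h2 with
  | hadd a b ha hb => simp only [mul_add, add_mul, map_add, AddMonoidHom.add_apply, ha, hb]; abel
  | hpar i a ha =>
    rw [h.mul_left_of_isPar (isPar_algebraMap f) ha, h.algebraMap_left]
    simp [sub_eq_add_neg]

theorem algebraMap_mul_right (h2 : IsUnit (2 : A)) (f : A) (a x : B) :
    br a (algebraMap A B f * x) = algebraMap A B f * br a x + br a (algebraMap A B f) * x := by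
  induction a using isPar_induction h2 with
  | hadd a b ha hb => simp only [mul_add, add_mul, map_add, AddMonoidHom.add_apply, ha, hb]; abel
  | hpar i a ha => rw [h.bracket_mul ha, AlgHom.commutes, add_comm]

theorem bracket_smul_right (h2 : IsUnit (2 : A)) (c : K) (a x : B) :
    br a (algebraMap K A c • x) = algebraMap K A c • br a x := by
  rw [Algebra.smul_def, h.algebraMap_mul_right h2, h.bracket_scalar, zero_mul, add_zero,
    Algebra.smul_def]

theorem bracket_smul_left (h2 : IsUnit (2 : A)) (c : K) (a x : B) :
    br (algebraMap K A c • a) x = algebraMap K A c • br a x := by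
  rw [Algebra.smul_def, h.algebraMap_mul_left h2, contr_algebraMap_left, mul_zero, sub_zero,
    Algebra.smul_def]

theorem bracket_mem_gr {i j : ℤ} {a b : B} (ha : a ∈ gr A M i) (hb : b ∈ gr A M j) :
    br a b ∈ gr A M (i + j - 1) := by
  refine gr_induction (P := fun j b => br a b ∈ gr A M (i + j - 1)) (fun n => by simp)
    (fun n x y hx hy => ?_) (fun f => ?_) (fun n D x hx hx' => ?_) hb
  · rw [map_add]; exact add_mem hx hy
  · have hc := R.contr_mem_gr f ha
    rw [h.map_algebraMap, (isPar_of_mem_gr hc).twist_eq, add_zero]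
    exact neg_one_pow_smul_mem_gr hc _
  · rw [h.bracket_mul (isPar_of_mem_gr ha), h.map_ι, twist_ι, smul_mul_assoc]
    have h1 := mul_mem_gr (neg_mem (R.lieDer_mem_gr D ha)) hx
    have h2 := neg_one_pow_smul_mem_gr (ι_mul_mem_gr D hx') (paritySign ((i : ZMod 2) + 1))
    rw [show i + (n + 1) - 1 = i + n by ring]
    rw [show i + n - 1 + 1 = i + n by ring] at h2
    exact add_mem h1 h2

/-- Moving `D_i` to the right end, where it acts as a Lie derivative, passes `m - i` factors; the
parity of `m - i` is that of `m + i`. -/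
theorem bracket_ιMulti (h2 : IsUnit (2 : A)) (m : ℕ) (D : Fin (m + 1) → M) (x : B) :
    br (ιMulti A (m + 1) D) x =
      ∑ i : Fin (m + 1), (-1) ^ (m + i.1) *
        (ιMulti A m (i.removeNth D) * R.lieDer (D i) x) := by
  induction m with
  | zero =>
    rw [ιMulti_succ_apply]
    simp [h.ι_left]
  | succ n ih =>
    rw [ιMulti_succ_apply, h.ι_mul_left h2, ih, Fin.sum_univ_succ (n := n + 1),
      Finset.mul_sum, add_comm]
    congr 1
    · rw [twist_one_ιMulti, mul_assoc]
      simp [Matrix.vecTail, Fin.removeNth_zero, Fin.tail_def, Function.comp_def]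
    · refine Finset.sum_congr rfl fun j _ => ?_
      rw [ιMulti_removeNth_succ, Fin.val_succ]
      rcases neg_one_pow_eq_or B j.1 with h | h <;> rcases neg_one_pow_eq_or B n with h' | h' <;>
        simp [pow_add, h, h', Matrix.vecTail, mul_assoc]

theorem bracket_ιMulti_ιMulti (h2 : IsUnit (2 : A)) (m n : ℕ) (D : Fin (m + 1) → M)
    (F : Fin (n + 1) → M) :
    br (ιMulti A (m + 1) D) (ιMulti A (n + 1) F) =
      ∑ i : Fin (m + 1), ∑ j : Fin (n + 1), (-1) ^ (i.1 + j.1) *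
        (ι A (R.bracket (D i) (F j)) * ιMulti A m (i.removeNth D) *
          ιMulti A n (j.removeNth F)) := by
  rw [h.bracket_ιMulti h2]
  refine Finset.sum_congr rfl fun i _ => ?_
  rw [lieDer_ιMulti, Finset.mul_sum, Finset.mul_sum]
  refine Finset.sum_congr rfl fun j _ => ?_
  -- Passing the bracket across the `m` remaining factors produces `(-1)^m`, which cancels the one
  -- from `bracket_ιMulti`.
  rw [ι_mul_eq (ιMulti A m _), twist_one_ιMulti]
  rcases neg_one_pow_eq_or B i.1 with h | h <;> rcases neg_one_pow_eq_or B j.1 with h' | h' <;>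
    rcases neg_one_pow_eq_or B m with h'' | h'' <;> simp [pow_add, h, h', h'', mul_assoc]

end IsSchouten

/-! ### Functoriality of the Schouten bracket. -/

section Functoriality

variable {A' M' : Type*} [CommRing A'] [Algebra K A'] [AddCommGroup M'] [Module A' M']
  {R} {R' : LieRinehartStr K A' M'} {ρ : A → A'} {φ : M → M'}
  {Ψ : ExteriorAlgebra A M →+* ExteriorAlgebra A' M'}
  (hΨ0 : ∀ f, Ψ (algebraMap A _ f) = algebraMap A' _ (ρ f)) (hΨ1 : ∀ D, Ψ (ι A D) = ι A' (φ D))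
include hΨ0 hΨ1

theorem map_twist (i : ZMod 2) (x : B) : Ψ (twist i x) = twist i (Ψ x) := by
  induction x using ExteriorAlgebra.induction with
  | algebraMap r => simp [hΨ0]
  | ι y =>
    obtain rfl | rfl := i.eq_zero_or_one_of_two <;> simp [hΨ1]
  | mul x y hx hy => simp [hx, hy]
  | add x y hx hy => simp [hx, hy]

variable (hanchor : ∀ D f, ρ (R.anchor D f) = R'.anchor (φ D) (ρ f))
  (hbracket : ∀ D D', φ (R.bracket D D') = R'.bracket (φ D) (φ D'))
include hanchor

theorem map_contr (f : A) (x : B) : Ψ (R.contr f x) = R'.contr (ρ f) (Ψ x) :=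
  ext_skewDer (d := fun x => Ψ (R.contr f x)) (d' := fun x => R'.contr (ρ f) (Ψ x))
    (f := Ψ) (g := Ψ.comp (twist 1 : B →ₐ[A] B).toRingHom)
    (by simp) (by simp) (fun x y => by simp [contr_mul])
    (fun x y => by simp [contr_mul, map_twist hΨ0 hΨ1]) (by simp [hΨ0])
    (by simp [hΨ0, hΨ1, hanchor]) x

include hbracket

theorem map_lieDer (D : M) (x : B) : Ψ (R.lieDer D x) = R'.lieDer (φ D) (Ψ x) :=
  ext_skewDer (d := fun x => Ψ (R.lieDer D x)) (d' := fun x => R'.lieDer (φ D) (Ψ x))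
    (f := Ψ) (g := Ψ)
    (by simp) (by simp) (fun x y => by simp [lieDer_mul])
    (fun x y => by simp [lieDer_mul]) (by simp [hΨ0, hanchor])
    (by simp [hΨ1, hbracket]) x

theorem IsSchouten.map_bracket (h2 : IsUnit (2 : A))
    {br : ExteriorAlgebra A M →+ ExteriorAlgebra A M →+ ExteriorAlgebra A M}
    (h : R.IsSchouten br)
    {br' : ExteriorAlgebra A' M' →+ ExteriorAlgebra A' M' →+ ExteriorAlgebra A' M'}
    (h' : R'.IsSchouten br') (a b : B) : Ψ (br a b) = br' (Ψ a) (Ψ b) := by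
  induction a using isPar_induction h2 with
  | hadd a b ha hb => simp only [map_add, AddMonoidHom.add_apply, ha, hb]
  | hpar i a ha =>
    have ha' : IsPar i (Ψ a) := by
      unfold IsPar at *
      rw [← map_twist hΨ0 hΨ1, ha]
      obtain rfl | rfl := i.eq_zero_or_one_of_two <;> simp
    exact ext_skewDer (d := fun x => Ψ (br a x)) (d' := fun x => br' (Ψ a) (Ψ x))
      (f := Ψ) (g := Ψ.comp (twist (i + 1) : B →ₐ[A] B).toRingHom)
      (by simp) (by simp) (fun x y => by simp [h.bracket_mul ha])
      (fun x y => by simp [h'.bracket_mul ha', map_twist hΨ0 hΨ1])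
      (by simp [hΨ0, h.map_algebraMap, h'.map_algebraMap, map_twist hΨ0 hΨ1,
        map_contr hΨ0 hΨ1 hanchor])
      (by simp [hΨ1, h.map_ι, h'.map_ι, map_lieDer hΨ0 hΨ1 hanchor hbracket]) b

end Functoriality

end LieRinehartStr

/-! ### Gluing, and sections of the sheafified exterior algebra. -/

namespace TopCat.Sheaf

variable {C : Type*} [Category* C] {FC : C → C → Type*} {CC : C → Type u}
  [∀ X Y, FunLike (FC X Y) (CC X) (CC Y)] [ConcreteCategory C FC]
  [Limits.HasLimitsOfSize.{u, u} C] [(CategoryTheory.forget C).ReflectsIsomorphisms]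
  [Limits.PreservesLimitsOfSize.{u, u} (CategoryTheory.forget C)] {X : TopCat.{u}}
  (F : TopCat.Sheaf C X)

theorem eq_of_locally_eq_nhds {U : Opens X} (s t : ToType (F.1.obj (op U)))
    (h : ∀ x ∈ U, ∃ (V : Opens X) (hV : V ≤ U), x ∈ V ∧
      F.1.map (homOfLE hV).op s = F.1.map (homOfLE hV).op t) : s = t := by
  choose! V hV hx heq using h
  refine F.eq_of_locally_eq' (fun x : U => V x.1) U (fun x => homOfLE (hV x.1 x.2))
    (fun x hxU => Opens.mem_iSup.2 ⟨⟨x, hxU⟩, hx x hxU⟩) s t fun x => heq x.1 x.2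

theorem exists_glue {U : Opens X} {ι : Type*} (V : ι → Opens X) (hV : ∀ i, V i ≤ U)
    (hcover : ∀ x ∈ U, ∃ i, x ∈ V i) (s : ∀ i, ToType (F.1.obj (op (V i))))
    (hs : ∀ i j, ∀ (W : Opens X) (hi : W ≤ V i) (hj : W ≤ V j),
      F.1.map (homOfLE hi).op (s i) = F.1.map (homOfLE hj).op (s j)) :
    ∃ t : ToType (F.1.obj (op U)), ∀ i, F.1.map (homOfLE (hV i)).op t = s i :=
  (F.existsUnique_gluing' V U (fun i => homOfLE (hV i))
    (fun x hx => Opens.mem_iSup.2 (hcover x hx)) s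
    fun i j => hs i j _ inf_le_left inf_le_right).exists

end TopCat.Sheaf

noncomputable section

variable {K : Type u} [Field K] [TopologicalSpace K] {X : TopCat.{u}} {𝒪 : TopRingedSpace K X}

namespace TopRingedSpace

theorem Γ_eq_of_local {U : Opens X} (f g : 𝒪.Γ U)
    (h : ∀ x ∈ U, ∃ (V : Opens X) (hV : V ≤ U), x ∈ V ∧ 𝒪.res hV f = 𝒪.res hV g) : f = g :=
  TopCat.Sheaf.eq_of_locally_eq_nhds (C := RingCat.{u}) 𝒪.sheaf f g h

theorem Γ_glue {U : Opens X} {ι : Type*} (V : ι → Opens X) (hV : ∀ i, V i ≤ U)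
    (hcover : ∀ x ∈ U, ∃ i, x ∈ V i) (s : ∀ i, 𝒪.Γ (V i))
    (hs : ∀ i j, ∀ (W : Opens X) (hi : W ≤ V i) (hj : W ≤ V j),
      𝒪.res hi (s i) = 𝒪.res hj (s j)) :
    ∃ t : 𝒪.Γ U, ∀ i, 𝒪.res (hV i) t = s i := by
  have := TopCat.Sheaf.exists_glue (C := RingCat.{u}) 𝒪.sheaf V hV hcover s hs
  exact this

theorem isUnit_two [CharZero K] (U : Opens X) : IsUnit (2 : 𝒪.Γ U) := by
  have : (2 : 𝒪.Γ U) = algebraMap K (𝒪.Γ U) 2 := (map_ofNat _ 2).symm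
  rw [this]
  exact (isUnit_iff_ne_zero.2 two_ne_zero).map _

end TopRingedSpace

namespace OModule

variable (E : 𝒪.Modules)

theorem eq_of_local {U : Opens X} (s t : Sec E U)
    (h : ∀ x ∈ U, ∃ (V : Opens X) (hV : V ≤ U), x ∈ V ∧ res E hV s = res E hV t) : s = t :=
  TopCat.Sheaf.eq_of_locally_eq_nhds (C := AddCommGrpCat.{u}) ⟨_, E.isSheaf⟩ s t h

theorem glue {U : Opens X} {ι : Type*} (V : ι → Opens X) (hV : ∀ i, V i ≤ U)
    (hcover : ∀ x ∈ U, ∃ i, x ∈ V i) (s : ∀ i, Sec E (V i))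
    (hs : ∀ i j, ∀ (W : Opens X) (hi : W ≤ V i) (hj : W ≤ V j),
      res E hi (s i) = res E hj (s j)) :
    ∃ t : Sec E U, ∀ i, res E (hV i) t = s i := by
  have := TopCat.Sheaf.exists_glue (C := AddCommGrpCat.{u}) ⟨_, E.isSheaf⟩ V hV hcover s hs
  exact this

theorem app_res {E F : 𝒪.Modules} (φ : E ⟶ F) {U V : Opens X} (h : V ≤ U) (D : Sec E U) :
    res F h (app φ U D) = app φ V (res E h D) :=
  (PresheafOfModules.naturality_apply φ.val (homOfLE h).op D).symm

end OModule

namespace ExtAlg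

variable (E : 𝒪.Modules)

theorem res_res {U V W : Opens X} (h : V ≤ U) (h' : W ≤ V) (s : Sec E U) :
    res E h' (res E h s) = res E (h'.trans h) s :=
  (ConcreteCategory.congr_hom ((sheaf E).obj.map_comp (homOfLE h).op (homOfLE h').op) s).symm

theorem res_self {U : Opens X} (h : U ≤ U) (s : Sec E U) : res E h s = s :=
  ConcreteCategory.congr_hom ((sheaf E).obj.map_id (op U)) s

theorem eq_of_local {U : Opens X} (s t : Sec E U)
    (h : ∀ x ∈ U, ∃ (V : Opens X) (hV : V ≤ U), x ∈ V ∧ res E hV s = res E hV t) : s = t :=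
  TopCat.Sheaf.eq_of_locally_eq_nhds (C := RingCat.{u}) (sheaf E) s t h

theorem glue {U : Opens X} {ι : Type*} (V : ι → Opens X) (hV : ∀ i, V i ≤ U)
    (hcover : ∀ x ∈ U, ∃ i, x ∈ V i) (s : ∀ i, Sec E (V i))
    (hs : ∀ i j, ∀ (W : Opens X) (hi : W ≤ V i) (hj : W ≤ V j),
      res E hi (s i) = res E hj (s j)) :
    ∃ t : Sec E U, ∀ i, res E (hV i) t = s i :=
  TopCat.Sheaf.exists_glue (C := RingCat.{u}) (sheaf E) V hV hcover s hs

theorem res_of {U V : Opens X} (h : V ≤ U) (p : ExteriorAlgebra (𝒪.Γ U) (OModule.Sec E U)) :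
    res E h (of E U p) = of E V (presheafMap E h p) :=
  (ConcreteCategory.congr_hom ((toSheafify (Opens.grothendieckTopology X) (presheaf E)).naturality
    (homOfLE h).op) p).symm

theorem exists_of {U : Opens X} (s : Sec E U) {x : X} (hx : x ∈ U) :
    ∃ (V : Opens X) (h : V ≤ U), x ∈ V ∧ ∃ p, of E V p = res E h s := by
  obtain ⟨V, i, hi, hxV⟩ := Presheaf.imageSieve_mem (Opens.grothendieckTopology X)
    (toSheafify (Opens.grothendieckTopology X) (presheaf E)) (U := op U) s x hx
  exact ⟨V, leOfHom i, hxV, hi⟩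

theorem of_eq {U : Opens X} {p q : ExteriorAlgebra (𝒪.Γ U) (OModule.Sec E U)}
    (h : of E U p = of E U q) {x : X} (hx : x ∈ U) :
    ∃ (V : Opens X) (h : V ≤ U), x ∈ V ∧ presheafMap E h p = presheafMap E h q := by
  obtain ⟨V, i, hi, hxV⟩ := Presheaf.equalizerSieve_mem (Opens.grothendieckTopology X)
    (toSheafify (Opens.grothendieckTopology X) (presheaf E)) (X := op U) p q h x hx
  exact ⟨V, leOfHom i, hxV, hi⟩

theorem presheafMap_mem_gr {U V : Opens X} (h : V ≤ U) {n : ℤ}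
    {p : ExteriorAlgebra (𝒪.Γ U) (OModule.Sec E U)} (hp : p ∈ gr _ _ n) :
    presheafMap E h p ∈ gr (𝒪.Γ V) (OModule.Sec E V) n := by
  refine ExteriorAlgebra.gr_induction (P := fun n p => presheafMap E h p ∈ gr _ _ n)
    (fun n => by simp) (fun n x y hx hy => ?_) (fun f => ?_) (fun n D x _ hx => ?_) hp
  · rw [map_add]; exact add_mem hx hy
  · rw [presheafMap_algebraMap]; exact ExteriorAlgebra.algebraMap_mem_gr _
  · rw [map_mul, presheafMap_ι]; exact ExteriorAlgebra.ι_mul_mem_gr _ hx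

theorem isHomog_of {U : Opens X} {n : ℤ} {p : ExteriorAlgebra (𝒪.Γ U) (OModule.Sec E U)}
    (hp : p ∈ gr _ _ n) : IsHomog E n (of E U p) :=
  fun _ hx => ⟨U, le_rfl, hx, p, hp, (res_self E _ _).symm⟩

theorem isHomog_of_local {U : Opens X} {n : ℤ} {s : Sec E U}
    (h : ∀ x ∈ U, ∃ (V : Opens X) (hV : V ≤ U), x ∈ V ∧ IsHomog E n (ExtAlg.res E hV s)) :
    IsHomog E n s := by
  intro x hx
  obtain ⟨V, hV, hxV, hs⟩ := h x hx
  obtain ⟨W, hW, hxW, p, hp, hps⟩ := hs x hxV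
  exact ⟨W, hW.trans hV, hxW, p, hp, hps.trans (res_res E _ _ _)⟩

theorem isHomog_ι {U : Opens X} (D : OModule.Sec E U) : IsHomog E 1 (ι E U D) :=
  isHomog_of E (ExteriorAlgebra.ι_mem_gr D)

theorem isHomog_scalar {U : Opens X} (f : 𝒪.Γ U) : IsHomog E 0 (scalar E U f) :=
  isHomog_of E (ExteriorAlgebra.algebraMap_mem_gr f)

theorem eq_zero_of_isHomog_neg {U : Opens X} {n : ℤ} (hn : n < 0) {s : Sec E U}
    (hs : IsHomog E n s) : s = 0 := by
  refine eq_of_local E _ _ fun x hx => ?_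
  obtain ⟨W, hW, hxW, p, hp, hps⟩ := hs x hx
  rw [ExteriorAlgebra.gr_of_neg hn, Submodule.mem_bot] at hp
  exact ⟨W, hW, hxW, by rw [← hps, hp, map_zero, map_zero]⟩

theorem smul_def {U : Opens X} (c : K) (s : Sec E U) :
    c • s = scalar E U (algebraMap K (𝒪.Γ U) c) * s := rfl

theorem res_scalar {U V : Opens X} (h : V ≤ U) (f : 𝒪.Γ U) :
    res E h (scalar E U f) = scalar E V (𝒪.res h f) :=
  (res_of E h _).trans (congrArg _ (presheafMap_algebraMap E h f))

theorem res_ι {U V : Opens X} (h : V ≤ U) (D : OModule.Sec E U) :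
    res E h (ι E U D) = ι E V (OModule.res E h D) :=
  (res_of E h _).trans (congrArg _ (presheafMap_ι E h D))

/-- `ι` as a linear map. -/
def ιₗ (U : Opens X) : OModule.Sec E U →ₗ[𝒪.Γ U] Sec E U where
  toFun := ι E U
  map_add' D D' := by simp [ι]
  map_smul' f D := by
    rw [ι, map_smul, Algebra.smul_def, map_mul]; rfl

theorem ι_add {U : Opens X} (D D' : OModule.Sec E U) : ι E U (D + D') = ι E U D + ι E U D' :=
  map_add (ιₗ E U) D D'

theorem ι_smul {U : Opens X} (f : 𝒪.Γ U) (D : OModule.Sec E U) :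
    ι E U (f • D) = scalar E U f * ι E U D :=
  map_smul (ιₗ E U) f D

theorem ι_injective (U : Opens X) : Function.Injective (ι E U) := by
  intro D D' h
  refine OModule.eq_of_local E _ _ fun x hx => ?_
  obtain ⟨V, hV, hxV, h'⟩ := of_eq E h hx
  rw [presheafMap_ι, presheafMap_ι, ExteriorAlgebra.ι_inj] at h'
  exact ⟨V, hV, hxV, h'⟩

theorem scalar_injective (U : Opens X) : Function.Injective (scalar E U) := by
  intro f g h
  refine TopRingedSpace.Γ_eq_of_local _ _ fun x hx => ?_
  obtain ⟨V, hV, hxV, h'⟩ := of_eq E h hx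
  rw [presheafMap_algebraMap, presheafMap_algebraMap, ExteriorAlgebra.algebraMap_inj] at h'
  exact ⟨V, hV, hxV, h'⟩

/-- Local preimages exist by definition of degree 1. By `ι_injective` they agree on overlaps, and
`E` is already a sheaf, so they glue. -/
theorem exists_ι_of_isHomog {U : Opens X} {s : Sec E U} (hs : IsHomog E 1 s) :
    ∃ D, ι E U D = s := by
  have h : ∀ x : U, ∃ (V : Opens X) (h : V ≤ U), x.1 ∈ V ∧ ∃ D, ι E V D = res E h s := by
    intro x
    obtain ⟨V, hV, hxV, p, hp, hps⟩ := hs x.1 x.2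
    change p ∈ gr _ _ ((1 : ℕ) : ℤ) at hp
    rw [ExteriorAlgebra.gr_natCast, ExteriorAlgebra.exteriorPower, pow_one] at hp
    obtain ⟨D, rfl⟩ := hp
    exact ⟨V, hV, hxV, D, hps⟩
  choose V hV hx D hD using h
  obtain ⟨t, ht⟩ := OModule.glue E V hV (fun x hxU => ⟨⟨x, hxU⟩, hx _⟩) D fun i j W hi hj => by
    apply ι_injective
    rw [← res_ι, ← res_ι, hD, hD, res_res, res_res]
  refine ⟨t, eq_of_local E _ _ fun x hxU => ⟨V ⟨x, hxU⟩, hV _, hx _, ?_⟩⟩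
  rw [res_ι, ht, hD]

theorem exists_scalar_of_isHomog {U : Opens X} {s : Sec E U} (hs : IsHomog E 0 s) :
    ∃ f, scalar E U f = s := by
  have h : ∀ x : U, ∃ (V : Opens X) (h : V ≤ U), x.1 ∈ V ∧ ∃ f, scalar E V f = res E h s := by
    intro x
    obtain ⟨V, hV, hxV, p, hp, hps⟩ := hs x.1 x.2
    change p ∈ gr _ _ ((0 : ℕ) : ℤ) at hp
    rw [ExteriorAlgebra.gr_natCast, ExteriorAlgebra.exteriorPower, pow_zero] at hp
    obtain ⟨f, rfl⟩ := Submodule.mem_one.1 hp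
    exact ⟨V, hV, hxV, f, hps⟩
  choose V hV hx f hf using h
  obtain ⟨t, ht⟩ := TopRingedSpace.Γ_glue V hV (fun x hxU => ⟨⟨x, hxU⟩, hx _⟩) f
    fun i j W hi hj => by
      apply scalar_injective E
      rw [← res_scalar, ← res_scalar, hf, hf, res_res, res_res]
  refine ⟨t, eq_of_local E _ _ fun x hxU => ⟨V ⟨x, hxU⟩, hV _, hx _, ?_⟩⟩
  rw [res_scalar, ht, hf]

theorem exists_of₂ {U : Opens X} (s t : Sec E U) {x : X} (hx : x ∈ U) :
    ∃ (V : Opens X) (h : V ≤ U), x ∈ V ∧ ∃ p q, of E V p = res E h s ∧ of E V q = res E h t := by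
  obtain ⟨V, hV, hxV, p, hp⟩ := exists_of E s hx
  obtain ⟨W, hW, hxW, q, hq⟩ := exists_of E t hx
  refine ⟨V ⊓ W, inf_le_left.trans hV, ⟨hxV, hxW⟩, presheafMap E inf_le_left p,
    presheafMap E inf_le_right q, ?_, ?_⟩
  · rw [← res_of, hp, res_res]
  · rw [← res_of, hq, res_res]

theorem presheafMap_comp {U V W : Opens X} (h : V ≤ U) (h' : W ≤ V)
    (p : ExteriorAlgebra (𝒪.Γ U) (OModule.Sec E U)) :
    presheafMap E h' (presheafMap E h p) = presheafMap E (h'.trans h) p :=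
  (ConcreteCategory.congr_hom ((presheaf E).map_comp (homOfLE h).op (homOfLE h').op) p).symm

end ExtAlg
end

/-- The Gerstenhaber axioms speak of integer degrees, so splitting by parity is not enough. Sums of
homogeneous elements are stable under left multiplication by generators, hence exhaust the algebra.
-/
theorem ExteriorAlgebra.gr_add_induction {A M : Type*} [CommRing A] [AddCommGroup M] [Module A M]
    {P : ExteriorAlgebra A M → Prop} (hadd : ∀ x y, P x → P y → P (x + y))
    (hgr : ∀ n x, x ∈ ExtAlg.gr A M n → P x) (x : ExteriorAlgebra A M) : P x := by
  have hx : x ∈ AddSubmonoid.closure {y | ∃ n, y ∈ ExtAlg.gr A M n} := by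
    induction x using CliffordAlgebra.left_induction with
    | algebraMap f => exact AddSubmonoid.subset_closure ⟨0, algebraMap_mem_gr f⟩
    | add x y hx hy => exact add_mem hx hy
    | ι_mul x D hx =>
      induction hx using AddSubmonoid.closure_induction with
      | mem y hy =>
        obtain ⟨n, hn⟩ := hy
        exact AddSubmonoid.subset_closure ⟨n + 1, ι_mul_mem_gr D hn⟩
      | zero => rw [mul_zero]; exact zero_mem _
      | add y z _ _ hy hz => rw [mul_add]; exact add_mem hy hz
  induction hx using AddSubmonoid.closure_induction with
  | mem y hy => exact hgr _ _ hy.choose_spec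
  | zero => exact hgr 0 0 (zero_mem _)
  | add y z _ _ hy hz => exact hadd _ _ hy hz

/-! ### Local operations on the sheafification. -/

noncomputable section

variable {K : Type u} [Field K] [TopologicalSpace K] {X : TopCat.{u}} {𝒪 : TopRingedSpace K X}

namespace ExtAlg

variable (E : 𝒪.Modules)

/-- A local operation on the presheaf `U ↦ ⋀_{𝒪(U)} E(U)` extends to its sheafification. -/
theorem exists_extend₂
    (F : ∀ U : Opens X, ExteriorAlgebra (𝒪.Γ U) (OModule.Sec E U) →
      ExteriorAlgebra (𝒪.Γ U) (OModule.Sec E U) → Sec E U)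
    (hF : ∀ {U V : Opens X} (h : V ≤ U) p q,
      res E h (F U p q) = F V (presheafMap E h p) (presheafMap E h q)) :
    ∃ br : ∀ U : Opens X, Sec E U → Sec E U → Sec E U,
      (∀ U p q, br U (of E U p) (of E U q) = F U p q) ∧
      ∀ {U V : Opens X} (h : V ≤ U) s t, res E h (br U s t) = br V (res E h s) (res E h t) := by
  have hwd : ∀ U p p' q q', of E U p = of E U p' → of E U q = of E U q' →
      F U p q = F U p' q' := by
    intro U p p' q q' hp hq
    refine eq_of_local E _ _ fun x hx => ?_
    obtain ⟨V, hV, hxV, h1⟩ := of_eq E hp hx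
    obtain ⟨W, hW, hxW, h2⟩ := of_eq E hq hx
    refine ⟨V ⊓ W, inf_le_left.trans hV, ⟨hxV, hxW⟩, ?_⟩
    rw [hF, hF, ← presheafMap_comp E hV inf_le_left p, h1, presheafMap_comp,
      ← presheafMap_comp E hW inf_le_right q, h2, presheafMap_comp]
  -- The value `r` is characterised by all local representatives at once, not only by the chosen
  -- ones; compatibility with `of` and with restriction is then immediate.
  have key : ∀ U (s t : Sec E U), ∃ r : Sec E U, ∀ (V : Opens X) (h : V ≤ U) p q,
      of E V p = res E h s → of E V q = res E h t → res E h r = F V p q := by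
    intro U s t
    choose V hV hxV p q hp hq using fun x : U => exists_of₂ E s t x.2
    obtain ⟨r, hr⟩ := glue E V hV (fun x hx => ⟨⟨x, hx⟩, hxV _⟩) (fun x => F (V x) (p x) (q x))
      fun i j W hi hj => by
        rw [hF, hF]
        apply hwd
        · rw [← res_of, ← res_of, hp, hp, res_res, res_res]
        · rw [← res_of, ← res_of, hq, hq, res_res, res_res]
    refine ⟨r, fun W hW p' q' hp' hq' => eq_of_local E _ _ fun x hx => ?_⟩
    let y : U := ⟨x, hW hx⟩
    refine ⟨W ⊓ V y, inf_le_left, ⟨hx, hxV y⟩, ?_⟩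
    rw [res_res, ← res_res E (hV y) inf_le_right, hr, hF, hF]
    apply hwd
    · rw [← res_of, ← res_of, hp, hp', res_res, res_res]
    · rw [← res_of, ← res_of, hq, hq', res_res, res_res]
  choose br hbr using key
  refine ⟨br, fun U p q => ?_, fun {U V} h s t => eq_of_local E _ _ fun x hx => ?_⟩
  · rw [← hbr U _ _ U le_rfl p q (res_self E _ _).symm (res_self E _ _).symm, res_self]
  · obtain ⟨W, hW, hxW, p, q, hp, hq⟩ := exists_of₂ E (res E h s) (res E h t) hx
    refine ⟨W, hW, hxW, ?_⟩
    rw [hbr V _ _ W hW p q hp hq, res_res,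
      hbr U s t W (hW.trans h) p q (hp.trans (res_res ..)) (hq.trans (res_res ..))]

/-- The predicates carry homogeneity: being stable under restriction, they survive the passage to a
common neighbourhood. -/
theorem exists_common {P Q R : ∀ V : Opens X, ExteriorAlgebra (𝒪.Γ V) (OModule.Sec E V) → Prop}
    (hP : ∀ {U V : Opens X} (h : V ≤ U) p, P U p → P V (presheafMap E h p))
    (hQ : ∀ {U V : Opens X} (h : V ≤ U) p, Q U p → Q V (presheafMap E h p))
    (hR : ∀ {U V : Opens X} (h : V ≤ U) p, R U p → R V (presheafMap E h p))
    {U : Opens X} {x : X} {a b c : Sec E U}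
    (ha : ∃ (V : Opens X) (h : V ≤ U), x ∈ V ∧ ∃ p, P V p ∧ of E V p = res E h a)
    (hb : ∃ (V : Opens X) (h : V ≤ U), x ∈ V ∧ ∃ p, Q V p ∧ of E V p = res E h b)
    (hc : ∃ (V : Opens X) (h : V ≤ U), x ∈ V ∧ ∃ p, R V p ∧ of E V p = res E h c) :
    ∃ (V : Opens X) (h : V ≤ U), x ∈ V ∧ ∃ p q r, P V p ∧ Q V q ∧ R V r ∧
      of E V p = res E h a ∧ of E V q = res E h b ∧ of E V r = res E h c := by
  obtain ⟨V₁, h₁, hx₁, p, hp, hpa⟩ := ha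
  obtain ⟨V₂, h₂, hx₂, q, hq, hqb⟩ := hb
  obtain ⟨V₃, h₃, hx₃, r, hr, hrc⟩ := hc
  refine ⟨V₁ ⊓ (V₂ ⊓ V₃), inf_le_left.trans h₁, ⟨hx₁, hx₂, hx₃⟩, presheafMap E inf_le_left p,
    presheafMap E (inf_le_right.trans inf_le_left) q,
    presheafMap E (inf_le_right.trans inf_le_right) r, hP _ _ hp, hQ _ _ hq, hR _ _ hr, ?_, ?_, ?_⟩
  · rw [← res_of, hpa, res_res]
  · rw [← res_of, hqb, res_res]
  · rw [← res_of, hrc, res_res]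

theorem exists_of₃ {U : Opens X} (a b c : Sec E U) {x : X} (hx : x ∈ U) :
    ∃ (V : Opens X) (h : V ≤ U), x ∈ V ∧ ∃ p q r,
      of E V p = res E h a ∧ of E V q = res E h b ∧ of E V r = res E h c := by
  have key (s : Sec E U) : ∃ (V : Opens X) (h : V ≤ U), x ∈ V ∧
      ∃ p, True ∧ of E V p = res E h s := by
    simpa using exists_of E s hx
  obtain ⟨V, h, hxV, p, q, r, -, -, -, H⟩ := exists_common E
    (P := fun _ _ => True) (Q := fun _ _ => True) (R := fun _ _ => True)
    (fun _ _ h => h) (fun _ _ h => h) (fun _ _ h => h) (key a) (key b) (key c)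
  exact ⟨V, h, hxV, p, q, r, H⟩

theorem exists_of_isHomog {U : Opens X} {i j : ℤ} {a b : Sec E U} (ha : IsHomog E i a)
    (hb : IsHomog E j b) (c : Sec E U) {x : X} (hx : x ∈ U) :
    ∃ (V : Opens X) (h : V ≤ U), x ∈ V ∧ ∃ p ∈ gr (𝒪.Γ V) (OModule.Sec E V) i,
      ∃ q ∈ gr (𝒪.Γ V) (OModule.Sec E V) j, ∃ r,
      of E V p = res E h a ∧ of E V q = res E h b ∧ of E V r = res E h c := by
  obtain ⟨V, h, hxV, p, q, r, hp, hq, -, H⟩ := exists_common E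
    (P := fun _ p => p ∈ gr _ _ i) (Q := fun _ p => p ∈ gr _ _ j) (R := fun _ _ => True)
    (fun h _ hp => presheafMap_mem_gr E h hp) (fun h _ hp => presheafMap_mem_gr E h hp)
    (fun _ _ h => h) (ha x hx) (hb x hx) (c := c) (by simpa using exists_of E c hx)
  exact ⟨V, h, hxV, p, hp, q, hq, r, H⟩

theorem map_smul_sign {B C F : Type*} [AddGroup B] [AddGroup C] [FunLike F B C]
    [AddMonoidHomClass F B C] (f : F) (ε : ℤˣ) (x : B) :
    f (ε • x) = ε • f x := by
  obtain rfl | rfl := Int.units_eq_one_or ε <;> simp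
end ExtAlg

/-! ### The Gerstenhaber structure of a Lie algebroid. -/

namespace LieAlgebroid

variable {E : 𝒪.Modules} (Λ : LieAlgebroid E)

/-- The Lie-Rinehart algebra of sections of a Lie algebroid. -/
def sections (U : Opens X) : LieRinehartStr K (𝒪.Γ U) (OModule.Sec E U) where
  bracket := AddMonoidHom.mk' (fun D => (Λ.bracket U D).toAddMonoidHom) fun D D' => by
    ext; simp
  anchor := Λ.anchor U
  bracket_self := Λ.bracket_self U
  jacobi := Λ.jacobi U
  anchor_bracket := Λ.anchor_bracket U
  leibniz := Λ.leibniz U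

variable [CharZero K]

/-- The Schouten bracket on the exterior algebra of `E(U)` over `𝒪(U)`. -/
def schouten (U : Opens X) : ExteriorAlgebra (𝒪.Γ U) (OModule.Sec E U) →+
    ExteriorAlgebra (𝒪.Γ U) (OModule.Sec E U) →+ ExteriorAlgebra (𝒪.Γ U) (OModule.Sec E U) :=
  ((Λ.sections U).exists_isSchouten (TopRingedSpace.isUnit_two U)).choose

theorem isSchouten_schouten (U : Opens X) : (Λ.sections U).IsSchouten (Λ.schouten U) :=
  ((Λ.sections U).exists_isSchouten (TopRingedSpace.isUnit_two U)).choose_spec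

theorem presheafMap_schouten {U V : Opens X} (h : V ≤ U)
    (p q : ExteriorAlgebra (𝒪.Γ U) (OModule.Sec E U)) :
    ExtAlg.presheafMap E h (Λ.schouten U p q) =
      Λ.schouten V (ExtAlg.presheafMap E h p) (ExtAlg.presheafMap E h q) :=
  LieRinehartStr.IsSchouten.map_bracket (ExtAlg.presheafMap_algebraMap E h)
    (ExtAlg.presheafMap_ι E h) (Λ.anchor_res h) (Λ.bracket_res h) (TopRingedSpace.isUnit_two U)
    (Λ.isSchouten_schouten U) (Λ.isSchouten_schouten V) p q

open ExtAlg in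
/-- The Schouten bracket extends to a Gerstenhaber structure on the sheaf `⋀ E`. -/
theorem exists_gerstenhaber : ∃ G : Gerstenhaber E, ∀ U p q,
    G.bracket U (of E U p) (of E U q) = of E U (Λ.schouten U p q) := by
  obtain ⟨br, hof, hres⟩ := exists_extend₂ E (fun U p q => of E U (Λ.schouten U p q))
    fun h p q => by rw [res_of, presheafMap_schouten]
  have h2 (U : Opens X) : IsUnit (2 : 𝒪.Γ U) := TopRingedSpace.isUnit_two U
  have hres_smul {U V : Opens X} (h : V ≤ U) (c : K) (s : Sec E U) :
      res E h (c • s) = c • res E h s := by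
    rw [smul_def, smul_def, map_mul, res_scalar, AlgHom.commutes]
  have hof_smul {U : Opens X} (c : K) (p : ExteriorAlgebra (𝒪.Γ U) (OModule.Sec E U)) :
      c • of E U p = of E U (algebraMap K (𝒪.Γ U) c • p) := by
    rw [smul_def, Algebra.smul_def, map_mul]; rfl
  let brₗ (U : Opens X) : Sec E U →ₗ[K] Sec E U →ₗ[K] Sec E U :=
    LinearMap.mk₂ K (br U)
      (fun a a' b => eq_of_local E _ _ fun x hx => by
        obtain ⟨V, h, hxV, p, q, r, hp, hq, hr⟩ := exists_of₃ E a a' b hx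
        exact ⟨V, h, hxV, by
          rw [map_add, hres, hres, hres, map_add, ← hp, ← hq, ← hr, ← map_add, hof, hof, hof,
            map_add (Λ.schouten V), AddMonoidHom.add_apply, map_add]⟩)
      (fun c a b => eq_of_local E _ _ fun x hx => by
        obtain ⟨V, h, hxV, p, q, hp, hq⟩ := exists_of₂ E a b hx
        refine ⟨V, h, hxV, ?_⟩
        simp only [hres, hres_smul, ← hp, ← hq, hof, hof_smul,
          (Λ.isSchouten_schouten V).bracket_smul_left (h2 V)])
      (fun a b b' => eq_of_local E _ _ fun x hx => by
        obtain ⟨V, h, hxV, p, q, r, hp, hq, hr⟩ := exists_of₃ E a b b' hx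
        exact ⟨V, h, hxV, by
          rw [map_add, hres, hres, hres, map_add, ← hp, ← hq, ← hr, ← map_add, hof, hof, hof,
            map_add, map_add]⟩)
      (fun c a b => eq_of_local E _ _ fun x hx => by
        obtain ⟨V, h, hxV, p, q, hp, hq⟩ := exists_of₂ E a b hx
        refine ⟨V, h, hxV, ?_⟩
        simp only [hres, hres_smul, ← hp, ← hq, hof, hof_smul,
          (Λ.isSchouten_schouten V).bracket_smul_right (h2 V)])
  refine ⟨⟨brₗ, fun h a b => hres h a b, fun U i j a b ha hb => ?_, fun U i j a b ha hb => ?_,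
    fun U i j a b c ha hb => ?_, fun U i j a b c ha hb => ?_⟩, hof⟩
  · refine isHomog_of_local E fun x hx => ?_
    obtain ⟨V, h, hxV, p, hp, q, hq, -, hpa, hqb, -⟩ := exists_of_isHomog E ha hb 0 hx
    refine ⟨V, h, hxV, ?_⟩
    change IsHomog E _ (res E h (br U a b))
    rw [hres, ← hpa, ← hqb, hof]
    exact isHomog_of E ((Λ.isSchouten_schouten V).bracket_mem_gr hp hq)
  · refine eq_of_local E _ _ fun x hx => ?_
    obtain ⟨V, h, hxV, p, hp, q, hq, -, hpa, hqb, -⟩ := exists_of_isHomog E ha hb 0 hx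
    refine ⟨V, h, hxV, ?_⟩
    have hp' := ExteriorAlgebra.isPar_of_mem_gr hp
    have hq' := ExteriorAlgebra.isPar_of_mem_gr hq
    change res E h (br U a b) = res E h (-(_ • br U b a))
    rw [map_neg, map_smul_sign, hres, hres, ← hpa, ← hqb, hof, hof,
      (Λ.isSchouten_schouten V).symm (h2 V) hq', hp'.twist_eq]
    simp only [map_smul_sign, smul_smul]
    rw [← paritySign_add, Int.negOnePow_eq_paritySign, ← Units.neg_smul]
    congr 2
    push_cast
    generalize (i : ZMod 2) = i, (j : ZMod 2) = j
    revert i j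
    decide
  · refine eq_of_local E _ _ fun x hx => ?_
    obtain ⟨V, h, hxV, p, hp, q, hq, r, hpa, hqb, hrc⟩ := exists_of_isHomog E ha hb c hx
    refine ⟨V, h, hxV, ?_⟩
    have hp' := ExteriorAlgebra.isPar_of_mem_gr hp
    have hq' := ExteriorAlgebra.isPar_of_mem_gr hq
    change res E h (br U a (br U b c)) = res E h (br U (br U a b) c + _ • br U b (br U a c))
    rw [map_add, map_smul_sign]
    simp only [hres, ← hpa, ← hqb, ← hrc, hof]
    rw [← map_smul_sign, ← map_add, (Λ.isSchouten_schouten V).jacobi (h2 V) hp' hq',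
      Int.negOnePow_eq_paritySign]
    push_cast
    -- Modulo 2 the shifts `i - 1` of the axioms are the shifts `i + 1` of the parity calculus.
    simp only [CharTwo.sub_eq_add]
  · refine eq_of_local E _ _ fun x hx => ?_
    obtain ⟨V, h, hxV, p, hp, q, hq, r, hpa, hqb, hrc⟩ := exists_of_isHomog E ha hb c hx
    refine ⟨V, h, hxV, ?_⟩
    have hp' := ExteriorAlgebra.isPar_of_mem_gr hp
    have hq' := ExteriorAlgebra.isPar_of_mem_gr hq
    change res E h (br U a (b * c)) = res E h (br U a b * c + _ • (b * br U a c))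
    rw [map_add, map_smul_sign]
    simp only [hres, map_mul, ← hpa, ← hqb, ← hrc, hof]
    simp only [← map_mul, ← map_smul_sign, ← map_add, hof]
    rw [(Λ.isSchouten_schouten V).bracket_mul hp', hq'.twist_eq, Int.negOnePow_eq_paritySign,
      smul_mul_assoc]
    push_cast
    simp only [CharTwo.sub_eq_add]

/-- The Gerstenhaber structure on `⋀ E` of a Lie algebroid structure on `E`. -/
def gerstenhaber : Gerstenhaber E := Λ.exists_gerstenhaber.choose

theorem gerstenhaber_of (U : Opens X) (p q : ExteriorAlgebra (𝒪.Γ U) (OModule.Sec E U)) :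
    Λ.gerstenhaber.bracket U (ExtAlg.of E U p) (ExtAlg.of E U q) =
      ExtAlg.of E U (Λ.schouten U p q) :=
  Λ.exists_gerstenhaber.choose_spec U p q

theorem gerstenhaber_isStandard : Λ.gerstenhaber.IsStandard Λ where
  bracket_scalar U D f := by
    refine (Λ.gerstenhaber_of U _ _).trans ?_
    rw [(Λ.isSchouten_schouten U).ι_left, LieRinehartStr.lieDer_algebraMap]
    rfl
  bracket_wedge U m n D F := by
    rw [gerstenhaber_of, (Λ.isSchouten_schouten U).bracket_ιMulti_ιMulti
      (TopRingedSpace.isUnit_two U)]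
    simp only [map_sum, map_mul, map_pow, map_neg, map_one]
    rfl

end LieAlgebroid

/-! ### Determination of brackets by generators. -/

namespace Gerstenhaber

open ExtAlg

variable {E L : 𝒪.Modules} (G : Gerstenhaber E) (G' : Gerstenhaber L) (ψ : ExtAlg.Hom E L)

theorem bracket_scalar_scalar {E : 𝒪.Modules} (G : Gerstenhaber E) (U : Opens X) (f g : 𝒪.Γ U) :
    G.bracket U (scalar E U f) (scalar E U g) = 0 :=
  eq_zero_of_isHomog_neg E (by norm_num)
    (G.bracket_homog U 0 0 _ _ (isHomog_scalar E f) (isHomog_scalar E g))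

variable {G G' ψ}

theorem map_bracket_swap {U : Opens X} {i j : ℤ} {a b : Sec E U} (ha : IsHomog E i a)
    (hb : IsHomog E j b)
    (h : ψ.app U (G.bracket U a b) = G'.bracket U (ψ.app U a) (ψ.app U b)) :
    ψ.app U (G.bracket U b a) = G'.bracket U (ψ.app U b) (ψ.app U a) := by
  rw [G.bracket_symm U j i b a hb ha, G'.bracket_symm U j i _ _ (ψ.app_homog U _ _ hb)
    (ψ.app_homog U _ _ ha), ← h, map_neg, map_smul_sign]

theorem map_bracket_of_right {U : Opens X} {i : ℤ} {a : Sec E U} (ha : IsHomog E i a)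
    (h0 : ∀ f, ψ.app U (G.bracket U a (scalar E U f)) =
      G'.bracket U (ψ.app U a) (ψ.app U (scalar E U f)))
    (h1 : ∀ D, ψ.app U (G.bracket U a (ι E U D)) =
      G'.bracket U (ψ.app U a) (ψ.app U (ι E U D)))
    (q : ExteriorAlgebra (𝒪.Γ U) (OModule.Sec E U)) :
    ψ.app U (G.bracket U a (of E U q)) = G'.bracket U (ψ.app U a) (ψ.app U (of E U q)) := by
  induction q using CliffordAlgebra.left_induction with
  | algebraMap f => exact h0 f
  | add x y hx hy => simp only [map_add, hx, hy]
  | ι_mul x D hx =>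
    have hmul : of E U (CliffordAlgebra.ι 0 D * x) = ι E U D * of E U x := map_mul (of E U) _ _
    rw [hmul, map_mul (ψ.app U), G.leibniz U i 1 a _ _ ha (isHomog_ι E D),
      G'.leibniz U i 1 _ _ _ (ψ.app_homog U _ _ ha) (ψ.app_homog U _ _ (isHomog_ι E D)),
      map_add, map_mul, map_smul_sign, map_mul, hx, h1]

/-- A morphism of graded algebras preserves the Gerstenhaber brackets if it does so on
generators. -/
theorem map_bracket_of_generators
    (h0 : ∀ U D f, ψ.app U (G.bracket U (ι E U D) (scalar E U f)) =
      G'.bracket U (ψ.app U (ι E U D)) (ψ.app U (scalar E U f)))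
    (h1 : ∀ U D D', ψ.app U (G.bracket U (ι E U D) (ι E U D')) =
      G'.bracket U (ψ.app U (ι E U D)) (ψ.app U (ι E U D')))
    (U : Opens X) (a b : Sec E U) :
    ψ.app U (G.bracket U a b) = G'.bracket U (ψ.app U a) (ψ.app U b) := by
  -- With a generator on the left, the Leibniz rule extends the claim to everything on the right.
  -- Antisymmetry then gives it for a homogeneous element on the left and a generator on the right,
  -- and the Leibniz rule applies once more.
  have hι U D q : ψ.app U (G.bracket U (ι E U D) (of E U q)) =
      G'.bracket U (ψ.app U (ι E U D)) (ψ.app U (of E U q)) :=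
    map_bracket_of_right (isHomog_ι E D) (h0 U D) (h1 U D) q
  have hscalar U f q : ψ.app U (G.bracket U (scalar E U f) (of E U q)) =
      G'.bracket U (ψ.app U (scalar E U f)) (ψ.app U (of E U q)) :=
    map_bracket_of_right (isHomog_scalar E f)
      (fun g => by simp only [ψ.app_scalar, bracket_scalar_scalar, map_zero])
      (fun D => map_bracket_swap (isHomog_ι E D) (isHomog_scalar E f) (h0 U D f)) q
  have hof U p q : ψ.app U (G.bracket U (of E U p) (of E U q)) =
      G'.bracket U (ψ.app U (of E U p)) (ψ.app U (of E U q)) := by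
    induction p using ExteriorAlgebra.gr_add_induction with
    | hadd x y hx hy => simp only [map_add, LinearMap.add_apply, hx, hy]
    | hgr n p hp =>
      exact map_bracket_of_right (isHomog_of E hp)
        (fun f => map_bracket_swap (isHomog_scalar E f) (isHomog_of E hp) (hscalar U f p))
        (fun D => map_bracket_swap (isHomog_ι E D) (isHomog_of E hp) (hι U D p)) q
  refine eq_of_local L _ _ fun x hx => ?_
  obtain ⟨V, h, hxV, p, q, hp, hq⟩ := exists_of₂ E a b hx
  refine ⟨V, h, hxV, ?_⟩
  rw [ψ.app_res, G.bracket_res, G'.bracket_res, ψ.app_res, ψ.app_res, ← hp, ← hq, hof]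

/-- Two brackets on the same algebra coincide when the identity preserves them, so this is a case of
`map_bracket_of_generators`. -/
theorem ext_of_generators {G G' : Gerstenhaber E}
    (h0 : ∀ U D f, G.bracket U (ι E U D) (scalar E U f) = G'.bracket U (ι E U D) (scalar E U f))
    (h1 : ∀ U D D', G.bracket U (ι E U D) (ι E U D') = G'.bracket U (ι E U D) (ι E U D')) :
    G = G' := by
  let ψ : ExtAlg.Hom E E :=
    ⟨fun U => RingHom.id _, fun _ _ => rfl, fun _ _ => rfl, fun _ _ _ h => h⟩
  ext U a b
  exact map_bracket_of_generators (ψ := ψ) h0 h1 U a b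

theorem IsStandard.bracket_ι {Λ : LieAlgebroid E} (hG : G.IsStandard Λ) (U : Opens X)
    (D D' : OModule.Sec E U) :
    G.bracket U (ι E U D) (ι E U D') = ι E U (Λ.bracket U D D') := by
  have := hG.bracket_wedge U 0 0 (fun _ => D) (fun _ => D')
  simpa [ι, ExteriorAlgebra.ιMulti_succ_apply] using this

theorem IsStandard.unique {Λ : LieAlgebroid E} {G G' : Gerstenhaber E} (hG : G.IsStandard Λ)
    (hG' : G'.IsStandard Λ) : G = G' :=
  ext_of_generators (fun U D f => by rw [hG.bracket_scalar, hG'.bracket_scalar])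
    fun U D D' => by rw [hG.bracket_ι, hG'.bracket_ι]

end Gerstenhaber
end

/-! ### Morphisms of exterior algebras, and restriction to degrees 0 and 1. -/

noncomputable section

variable {K : Type u} [Field K] [TopologicalSpace K] {X : TopCat.{u}} {𝒪 : TopRingedSpace K X}

namespace ExtAlg

variable {E L : 𝒪.Modules}

theorem hom_ext_of_generators {ψ ψ' : ExtAlg.Hom E L}
    (h : ∀ U D, ψ.app U (ι E U D) = ψ'.app U (ι E U D)) : ψ = ψ' := by
  have hof (U) : (ψ.app U).comp (of E U) = (ψ'.app U).comp (of E U) :=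
    ringHom_ext (fun f => (ψ.app_scalar U f).trans (ψ'.app_scalar U f).symm) (h U)
  ext U a
  refine eq_of_local L _ _ fun x hx => ?_
  obtain ⟨V, h, hxV, p, hp⟩ := exists_of E a hx
  refine ⟨V, h, hxV, ?_⟩
  rw [ψ.app_res, ψ'.app_res, ← hp]
  exact DFunLike.congr_fun (hof V) p

/-- The morphism of presheaves of rings induced by a morphism of `𝒪`-modules. -/
def presheafHom (φ : E ⟶ L) : presheaf E ⟶ presheaf L where
  app U := RingCat.ofHom (ExteriorAlgebra.map (OModule.app φ U.unop)).toRingHom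
  naturality {U V} i := by
    refine RingCat.hom_ext (ringHom_ext (fun f => ?_) (fun D => ?_))
    · change ExteriorAlgebra.map _ (presheafMap E _ _) = presheafMap L _ (ExteriorAlgebra.map _ _)
      rw [presheafMap_algebraMap, AlgHom.commutes, AlgHom.commutes, presheafMap_algebraMap]
    · change ExteriorAlgebra.map _ (presheafMap E _ _) = presheafMap L _ (ExteriorAlgebra.map _ _)
      rw [presheafMap_ι, ExteriorAlgebra.map_apply_ι, ExteriorAlgebra.map_apply_ι, presheafMap_ι,
        OModule.app_res]

/-- The ring homomorphism `(⋀ E)(U) → (⋀ L)(U)` induced by a morphism of `𝒪`-modules. -/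
def mapApp (φ : E ⟶ L) (U : Opens X) : Sec E U →+* Sec L U :=
  (((presheafToSheaf (Opens.grothendieckTopology X) RingCat.{u}).map (presheafHom φ)).hom.app
    (op U)).hom

theorem mapApp_of (φ : E ⟶ L) (U : Opens X) (p : ExteriorAlgebra (𝒪.Γ U) (OModule.Sec E U)) :
    mapApp φ U (of E U p) = of L U (ExteriorAlgebra.map (OModule.app φ U) p) :=
  (ConcreteCategory.congr_hom (NatTrans.congr_app
    (toSheafify_naturality (Opens.grothendieckTopology X) (presheafHom φ)) (op U)) p).symm

theorem map_mem_gr {A M N : Type*} [CommRing A] [AddCommGroup M] [Module A M] [AddCommGroup N]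
    [Module A N] (φ : M →ₗ[A] N) {n : ℤ} {p : ExteriorAlgebra A M} (hp : p ∈ gr A M n) :
    ExteriorAlgebra.map φ p ∈ gr A N n := by
  refine ExteriorAlgebra.gr_induction (P := fun n p => ExteriorAlgebra.map φ p ∈ gr _ _ n)
    (fun n => by simp) (fun n x y hx hy => ?_) (fun f => ?_) (fun n D x _ hx => ?_) hp
  · rw [map_add]; exact add_mem hx hy
  · rw [AlgHom.commutes]; exact ExteriorAlgebra.algebraMap_mem_gr _
  · rw [map_mul, ExteriorAlgebra.map_apply_ι]; exact ExteriorAlgebra.ι_mul_mem_gr _ hx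

/-- The homomorphism `⋀ E → ⋀ L` induced by a morphism of `𝒪`-modules. -/
def Hom.ofModuleHom (φ : E ⟶ L) : ExtAlg.Hom E L where
  app := mapApp φ
  app_res {U V} h a := (ConcreteCategory.congr_hom
    (((presheafToSheaf (Opens.grothendieckTopology X) RingCat.{u}).map
      (presheafHom φ)).hom.naturality (homOfLE h).op) a).symm
  app_scalar U f := (mapApp_of φ U _).trans (congrArg _ (AlgHom.commutes _ f))
  app_homog U n a ha x hx := by
    obtain ⟨V, h, hxV, p, hp, hpa⟩ := ha x hx
    refine ⟨V, h, hxV, _, map_mem_gr (OModule.app φ V) hp, ?_⟩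
    rw [← mapApp_of, hpa]
    exact ConcreteCategory.congr_hom (((presheafToSheaf (Opens.grothendieckTopology X)
      RingCat.{u}).map (presheafHom φ)).hom.naturality (homOfLE h).op) a

theorem Hom.ofModuleHom_ι (φ : E ⟶ L) (U : Opens X) (D : OModule.Sec E U) :
    (Hom.ofModuleHom φ).app U (ι E U D) = ι L U (OModule.app φ U D) :=
  (mapApp_of φ U _).trans (congrArg _ (ExteriorAlgebra.map_apply_ι _ _))

/-- A graded homomorphism sends `ι D` to degree 1, where sections come from `L`. Linearity and
naturality of the preimage follow from injectivity of `ι`. -/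
theorem Hom.exists_ofModuleHom (ψ : ExtAlg.Hom E L) :
    ∃ φ : E ⟶ L, ∀ U D, ψ.app U (ι E U D) = ι L U (OModule.app φ U D) := by
  choose f hf using fun (U : Opens X) (D : OModule.Sec E U) =>
    exists_ι_of_isHomog L (ψ.app_homog U 1 _ (isHomog_ι E D))
  let fₗ (U : Opens X) : OModule.Sec E U →ₗ[𝒪.Γ U] OModule.Sec L U :=
    { toFun := f U
      map_add' := fun D D' => ι_injective L U (by simp only [ι_add, hf, map_add])
      map_smul' := fun g D => ι_injective L U (by
        simp only [ι_smul, hf, map_mul, ψ.app_scalar, RingHom.id_apply]) }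
  have hres {U V : Opens X} (h : V ≤ U) (D : OModule.Sec E U) :
      OModule.res L h (f U D) = f V (OModule.res E h D) :=
    ι_injective L V (by rw [← res_ι, hf, hf, ψ.app_res, res_ι])
  refine ⟨⟨{ app := fun U => ModuleCat.ofHom (fₗ U.unop), naturality := fun {U V} i => ?_ }⟩,
    fun U D => (hf U D).symm⟩
  ext D
  exact (hres (leOfHom i.unop) D).symm

end ExtAlg

open ExtAlg in
/-- A Gerstenhaber structure on `⋀ E` restricts to a Lie algebroid structure on `E`. -/
theorem Gerstenhaber.exists_lieAlgebroid [CharZero K] {E : 𝒪.Modules} (G : Gerstenhaber E) :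
    ∃ Λ : LieAlgebroid E,
      (∀ U D D', G.bracket U (ι E U D) (ι E U D') = ι E U (Λ.bracket U D D')) ∧
      ∀ U D f, G.bracket U (ι E U D) (scalar E U f) = scalar E U (Λ.anchor U D f) := by
  have hι {U : Opens X} (D : OModule.Sec E U) := isHomog_ι E D
  have hsc {U : Opens X} (f : 𝒪.Γ U) := isHomog_scalar E f
  choose b hb using fun (U : Opens X) (D D' : OModule.Sec E U) =>
    exists_ι_of_isHomog E (G.bracket_homog U 1 1 _ _ (hι D) (hι D'))
  choose a ha using fun (U : Opens X) (D : OModule.Sec E U) (f : 𝒪.Γ U) =>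
    exists_scalar_of_isHomog E (G.bracket_homog U 1 0 _ _ (hι D) (hsc f))
  have hιK {U : Opens X} (c : K) (D : OModule.Sec E U) : ι E U (c • D) = c • ι E U D :=
    ι_smul E _ _
  have hscK {U : Opens X} (c : K) (f : 𝒪.Γ U) : scalar E U (c • f) = c • scalar E U f := by
    rw [Algebra.smul_def, map_mul]; rfl
  -- The free argument `s` serves twice, here and in `hjac`. With `s` a function these give that the
  -- anchor takes values in derivations and preserves brackets; with `s` in degree 1 they give the
  -- Leibniz and Jacobi identities of the Lie bracket.
  have hleib {U : Opens X} (D : OModule.Sec E U) (f : 𝒪.Γ U) (s : Sec E U) :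
      G.bracket U (ι E U D) (scalar E U f * s) =
        scalar E U (a U D f) * s + scalar E U f * G.bracket U (ι E U D) s := by
    rw [G.leibniz U 1 0 _ _ _ (hι D) (hsc f), ha]
    simp
  have hjac {U : Opens X} (D D' : OModule.Sec E U) (s : Sec E U) :
      G.bracket U (ι E U D) (G.bracket U (ι E U D') s) =
        G.bracket U (ι E U (b U D D')) s + G.bracket U (ι E U D') (G.bracket U (ι E U D) s) := by
    rw [G.jacobi U 1 1 _ _ _ (hι D) (hι D'), hb]
    simp
  -- Linearity of the anchor: after swapping, the Leibniz rule expands `[f, g D]`, and `[f, g]`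
  -- vanishes because its degree is `-1`.
  have hsmul {U : Opens X} (g : 𝒪.Γ U) (D : OModule.Sec E U) (f : 𝒪.Γ U) :
      G.bracket U (ι E U (g • D)) (scalar E U f) =
        scalar E U g * G.bracket U (ι E U D) (scalar E U f) := by
    rw [G.bracket_symm U 1 0 _ _ (hι _) (hsc f), ι_smul,
      G.leibniz U 0 0 _ _ _ (hsc f) (hsc g), G.bracket_scalar_scalar,
      G.bracket_symm U 1 0 _ _ (hι D) (hsc f)]
    simp
  let anchor (U : Opens X) (D : OModule.Sec E U) : Derivation K (𝒪.Γ U) (𝒪.Γ U) :=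
    Derivation.mk'
      { toFun := a U D
        map_add' := fun f g => scalar_injective E U (by simp only [map_add, ha])
        map_smul' := fun c f => scalar_injective E U (by
          simp only [hscK, ha, map_smul, RingHom.id_apply]) }
      fun f g => scalar_injective E U (by
        simp only [LinearMap.coe_mk, AddHom.coe_mk, smul_eq_mul, map_add, map_mul, ha, hleib]
        rw [add_comm, ← ha U D f, ← map_mul, mul_comm, map_mul])
  let Λ : LieAlgebroid E :=
    { bracket := fun U => LinearMap.mk₂ K (b U)
        (fun D D' D'' => ι_injective E U (by
          simp only [hb, ι_add, map_add, LinearMap.add_apply]))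
        (fun c D D' => ι_injective E U (by
          simp only [hb, hιK, map_smul, LinearMap.smul_apply]))
        (fun D D' D'' => ι_injective E U (by simp only [hb, ι_add, map_add]))
        (fun c D D' => ι_injective E U (by simp only [hb, hιK, map_smul]))
      anchor := fun U =>
        { toFun := anchor U
          map_add' := fun D D' => Derivation.ext fun f => scalar_injective E U (by
            change scalar E U (a U _ f) = scalar E U (a U D f + a U D' f)
            simp only [map_add, ha, ι_add, LinearMap.add_apply])
          map_smul' := fun g D => Derivation.ext fun f => scalar_injective E U (by
            change scalar E U (a U _ f) = scalar E U (g * a U D f)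
            simp only [map_mul, ha, hsmul]) }
      bracket_res := fun {U V} h D D' => ι_injective E V (by
        change ι E V (OModule.res E h (b U D D')) = ι E V (b V _ _)
        rw [← res_ι, hb, hb, G.bracket_res, res_ι, res_ι])
      anchor_res := fun {U V} h D f => scalar_injective E V (by
        change scalar E V (𝒪.res h (a U D f)) = scalar E V (a V _ _)
        rw [← res_scalar, ha, ha, G.bracket_res, res_ι, res_scalar])
      bracket_self := fun U D => ι_injective E U (by
        change ι E U (b U D D) = _
        have h := G.bracket_symm U 1 1 _ _ (hι D) (hι D)
        simp only [sub_self, mul_zero, Int.negOnePow_zero, one_smul] at h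
        rw [← hb] at h
        have h0 : ι E U 0 = 0 := map_zero (ιₗ E U)
        rw [h0]
        -- In degree 1 antisymmetry only gives `[D, D] = -[D, D]`; the characteristic makes this
        -- zero.
        have h2 : (2 : K) • ι E U (b U D D) = 0 := by
          rw [two_smul, ← sub_neg_eq_add, ← h, sub_self]
        exact (smul_eq_zero.1 h2).resolve_left two_ne_zero)
      jacobi := fun U D D' D'' => ι_injective E U (by
        change ι E U (b U D (b U D' D'')) = ι E U (b U (b U D D') D'' + b U D' (b U D D''))
        rw [ι_add, hb, hb, hb U _ D'', hb U D', hb U D D'', hjac])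
      anchor_bracket := fun U D D' => Derivation.ext fun f => scalar_injective E U (by
        rw [Derivation.commutator_apply]
        change scalar E U (a U (b U D D') f) = scalar E U (a U D (a U D' f) - a U D' (a U D f))
        rw [map_sub, ha, ha, ha, ha, ha, hjac, add_sub_cancel_right])
      leibniz := fun U D D' f => ι_injective E U (by
        change ι E U (b U D (f • D')) = ι E U (f • b U D D' + a U D f • D')
        rw [ι_add, hb, ι_smul, ι_smul, ι_smul, hleib, hb, add_comm]) }
  exact ⟨Λ, fun U D D' => (hb U D D').symm, fun U D f => (ha U D f).symm⟩

end

/-! ### The correspondence between the two kinds of structure. -/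

open ExtAlg in
theorem mainTheorem1 {K : Type u} [Field K] [CharZero K] [TopologicalSpace K] {X : TopCat.{u}}
    (𝒪 : TopRingedSpace K X) (E L : 𝒪.Modules) (ΛL : LieAlgebroid L) :
    (∃! G : Gerstenhaber L, G.IsStandard ΛL) ∧
    ∀ G : Gerstenhaber L, G.IsStandard ΛL →
      (Nonempty (RootedGerstenhaber E G) ↔ Nonempty (RootedLieAlgebroid E ΛL)) ∧
      (∀ S : RootedGerstenhaber E G, ∃! T : RootedLieAlgebroid E ΛL, RestrictsTo S T) ∧
      (∀ T : RootedLieAlgebroid E ΛL, ∃! S : RootedGerstenhaber E G, RestrictsTo S T) := by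
  refine ⟨⟨ΛL.gerstenhaber, ΛL.gerstenhaber_isStandard,
    fun G hG => hG.unique ΛL.gerstenhaber_isStandard⟩, fun G hG => ?_⟩
  have hST : ∀ S : RootedGerstenhaber E G, ∃! T : RootedLieAlgebroid E ΛL, RestrictsTo S T := by
    intro S
    obtain ⟨Λ, hb, ha⟩ := S.str.exists_lieAlgebroid
    obtain ⟨φ, hφ⟩ := S.hom.exists_ofModuleHom
    refine ⟨⟨Λ, φ, ⟨fun U D D' => ι_injective L U ?_, fun U D => Derivation.ext fun f =>
      scalar_injective L U ?_⟩⟩, ⟨hb, ha, hφ⟩, fun T hT => ?_⟩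
    · rw [← hφ, ← hb, S.map_bracket, hφ, hφ, hG.bracket_ι]
    · rw [← hG.bracket_scalar, ← hφ, ← S.hom.app_scalar, ← S.map_bracket, ha, S.hom.app_scalar]
    · refine RootedLieAlgebroid.ext (LieAlgebroid.ext ?_ ?_) ?_
      · funext U
        ext D D'
        exact ι_injective E U ((hT.bracket U D D').symm.trans (hb U D D'))
      · funext U
        ext D f
        exact scalar_injective E U ((hT.anchor U D f).symm.trans (ha U D f))
      · refine SheafOfModules.hom_ext (PresheafOfModules.hom_ext fun U => ?_)
        ext D
        exact ι_injective L U.unop ((hT.hom U.unop D).symm.trans (hφ U.unop D))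
  have hTS : ∀ T : RootedLieAlgebroid E ΛL, ∃! S : RootedGerstenhaber E G, RestrictsTo S T := by
    intro T
    have hT := T.str.gerstenhaber_isStandard
    -- The induced algebra morphism has to preserve brackets only on generators: on a section and a
    -- function this is compatibility with the anchors, on two sections it is compatibility with the
    -- Lie brackets.
    refine ⟨⟨T.str.gerstenhaber, Hom.ofModuleHom T.hom,
      Gerstenhaber.map_bracket_of_generators (fun U D f => ?_) (fun U D D' => ?_)⟩,
      ⟨hT.bracket_ι, hT.bracket_scalar, Hom.ofModuleHom_ι T.hom⟩, fun S hS => ?_⟩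
    · rw [hT.bracket_scalar, Hom.app_scalar, Hom.app_scalar, Hom.ofModuleHom_ι, hG.bracket_scalar,
        T.isHom.anchor_comp]
    · rw [hT.bracket_ι, Hom.ofModuleHom_ι, Hom.ofModuleHom_ι, Hom.ofModuleHom_ι, hG.bracket_ι,
        T.isHom.map_bracket]
    · refine RootedGerstenhaber.ext (Gerstenhaber.ext_of_generators (fun U D f => ?_)
        (fun U D D' => ?_)) (hom_ext_of_generators fun U D => ?_)
      · exact (hS.anchor U D f).trans (hT.bracket_scalar U D f).symm
      · exact (hS.bracket U D D').trans (hT.bracket_ι U D D').symm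
      · exact (hS.hom U D).trans (Hom.ofModuleHom_ι T.hom U D).symm
  exact ⟨⟨fun ⟨S⟩ => ⟨(hST S).choose⟩, fun ⟨T⟩ => ⟨(hTS T).choose⟩⟩, hST, hTS⟩
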